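/- **Theorem 1.2.** For natural numbers $h,g\ge 1$, a finite set $X\subset\mathbb{Z}$ is called a $B_h^+[g]$ set if every integer $n$ has at most $g$ representations $n=x_1+\dots+x_h$ with $x_1,\dots,x_h\in X$, and a $B_h^\times[g]$ set if every integer $n$ has at most $g$ representations $n=x_1\cdots x_h$ with $x_1,\dots,x_h\in X$; in both cases repetitions among the $x_i$ are allowed, and representations that differ only in the order of $x_1,\dots,x_h$ are regarded as the same. There is an absolute constant $c>0$ such that for every integer $h\ge 3$ there exist an integer $g$ with $1\le g\le 30h$, a real number $\delta_h\ge c\,h^{-3}$ and a real number $C_h>0$, all depending only on $h$, with the following property: every finite set $A\subset\mathbb{Z}$ contains a $B_h^+[g]$ set or a $B_h^\times[g]$ set of cardinality at least $C_h\,|A|^{1/h+\delta_h}$. -/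

import Mathlib

/-- `X` is a `B_h^+[g]` set: every integer `n` has at most `g` representations
`n = x₁ + ⋯ + x_h` with `x₁, …, x_h ∈ X` (repetitions allowed), where representations that differ
only in the order of the summands are identified. Such a representation is thus an unordered
`h`-tuple, i.e. an element of `X.sym h`. -/
def IsAddBhg (h g : ℕ) (X : Finset ℤ) : Prop :=
  ∀ n : ℤ, ((X.sym h).filter fun m : Sym ℤ h => (m : Multiset ℤ).sum = n).card ≤ g

/-- `X` is a `B_h^×[g]` set: every integer `n` has at most `g` representations
`n = x₁ ⋯ x_h` with `x₁, …, x_h ∈ X` (repetitions allowed), where representations that differ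
only in the order of the factors are identified. -/
def IsMulBhg (h g : ℕ) (X : Finset ℤ) : Prop :=
  ∀ n : ℤ, ((X.sym h).filter fun m : Sym ℤ h => (m : Multiset ℤ).prod = n).card ≤ g

/-!
The proof combines a sum-product dichotomy with the alteration method.

**Dichotomy.** Passing to the nonzero elements of one sign and to absolute values, one may work
with a finite set `exp L` of positive reals; its products are then governed by the sums of `L`.
If the additive energy of `exp L` is large, the Balog-Szemerédi-Gowers theorem
(`balog_szemeredi_gowers_add`) gives a large subset with small sumset, and Solymosi's inequality
(`addEnergy_le_card_exp_add_exp`) shows that its multiplicative energy is small. With a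
maximal disjoint family of such subsets one finds a subset `X` of at least half the size for which every number has
`O(|X| ^ (2 - 1 / 42))` representations either as a sum or as a product of three elements
(`exists_subset_tripleRep_le`). Hence a given number is the sum (or product) of at most
`O(|X| ^ (h - 1 - 1 / 42))` of the `h`-subsets of `X`.

**Alteration.** Let `δ = 1 / (60 h³)`, take a random subset of `X` of expected size
`|X| ^ (1 / h + δ)` and delete a point from each bad configuration (`exists_subset_no_edge`). There
are two kinds of these. A set of at most `ρ h` elements satisfying `ρ` independent linear relations
is rare because every relation costs a factor `|X|` (`card_hasRelations_mul_le`); as `ρ ≤ 30 h`,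
the choice of `δ` makes the loss `|X| ^ (ρ h δ)` negligible. A family of `27 h + 1` disjoint
`h`-subsets of equal sum is rare because of the power saving.

**Structure.** Without bad configurations no number has more than `30 h` representations
(`card_sym_filter_le`). The multiplicity vectors of distinct representations of one number turn out
to be linearly independent. Indeed, an independent family of representations must have large
support, hence total overlap less than `h`, and the span of such a family contains no further
multiset of size `h` (`mem_of_count_eq_sum`). Thus `30 h + 1` representations would have overlap
less than `h`, and all but `2 (h - 1)` of them would be pairwise disjoint sets, which is excluded.
-/

open Finset
open scoped Pointwise Combinatorics.Additive

/-! ### Additive energy and the Balog-Szemerédi-Gowers theorem -/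

section BalogSzemerediGowers

variable {G : Type*} [AddCommGroup G] [DecidableEq G]

/-- The elements `a` of `A` such that `a - d` also lies in `A`. Their number is the number of
representations of `d` as a difference of two elements of `A`. -/
def diffFiber (A : Finset G) (d : G) : Finset G := {a ∈ A | a - d ∈ A}

lemma card_diffFiber_le (A : Finset G) (d : G) : #(diffFiber A d) ≤ #A := card_filter_le _ _

lemma card_filter_sub_eq (A : Finset G) (d : G) :
    #{x ∈ A ×ˢ A | x.1 - x.2 = d} = #(diffFiber A d) := by
  refine card_bij (fun x _ => x.1) ?_ ?_ ?_
  · rintro ⟨x, y⟩ h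
    simp only [mem_filter, mem_product] at h
    simp only [diffFiber, mem_filter]
    refine ⟨h.1.1, ?_⟩
    rw [← h.2]; simpa using h.1.2
  · rintro ⟨x, y⟩ h ⟨x', y'⟩ h' e
    simp only [mem_filter, mem_product] at h h' e
    subst e
    have := h.2.trans h'.2.symm
    simpa using this
  · intro x hx
    simp only [diffFiber, mem_filter] at hx
    exact ⟨(x, x - d), by simp [hx.1, hx.2], rfl⟩

lemma sum_product_sub (A : Finset G) (f : G → ℕ) :
    ∑ x ∈ A ×ˢ A, f (x.1 - x.2) = ∑ d ∈ A - A, #(diffFiber A d) * f d := by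
  rw [← sum_fiberwise_of_maps_to (s := A ×ˢ A) (t := A - A) (g := fun x => x.1 - x.2)]
  · refine sum_congr rfl fun d _ => ?_
    rw [← card_filter_sub_eq, ← smul_eq_mul, ← sum_const]
    refine sum_congr rfl fun x hx => ?_
    rw [(mem_filter.1 hx).2]
  · intro x hx
    rw [mem_product] at hx
    exact sub_mem_sub hx.1 hx.2

lemma sum_card_diffFiber (A : Finset G) : ∑ d ∈ A - A, #(diffFiber A d) = #A ^ 2 := by
  have := sum_product_sub A (fun _ => 1)
  simpa [sq] using this.symm

lemma addEnergy_eq_sum_diffFiber (A B : Finset G) :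
    E[A, B] = ∑ d ∈ A - A, #(diffFiber A d) * #(diffFiber B d) := by
  rw [← sum_product_sub A (fun d => #(diffFiber B d)), addEnergy]
  rw [card_eq_sum_card_fiberwise (f := fun x => x.1) (t := A ×ˢ A)]
  · refine sum_congr rfl fun a ha => ?_
    rw [← card_filter_sub_eq]
    refine card_bij (fun x _ => (x.2.2, x.2.1)) ?_ ?_ ?_
    · rintro ⟨⟨a1, a2⟩, b1, b2⟩ h
      simp only [mem_filter, mem_product] at h ⊢
      obtain ⟨⟨⟨-, h2⟩, h3⟩, rfl⟩ := h
      refine ⟨⟨h2.2, h2.1⟩, ?_⟩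
      rw [sub_eq_sub_iff_add_eq_add]; rw [add_comm, ← h3, add_comm]
    · rintro ⟨a1, b1, b2⟩ h ⟨a1', b1', b2'⟩ h' e
      simp only [mem_filter] at h h'
      simp_all
    · rintro ⟨b2, b1⟩ h
      simp only [mem_filter, mem_product] at h
      refine ⟨(a, b1, b2), ?_, rfl⟩
      rw [mem_filter, mem_filter, mem_product, mem_product]
      refine ⟨⟨⟨mem_product.1 ha, mem_product.2 ⟨h.1.2, h.1.1⟩⟩, ?_⟩, rfl⟩
      have := h.2
      rw [sub_eq_sub_iff_add_eq_add] at this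
      rw [← this, add_comm]
  · rintro x hx
    simp only [coe_filter, Set.mem_ofPred_eq, mem_product] at hx
    simpa using hx.1.1

lemma addEnergy_self_eq_sum (A : Finset G) : E[A, A] = ∑ d ∈ A - A, #(diffFiber A d) ^ 2 := by
  simp [addEnergy_eq_sum_diffFiber, sq]

lemma addEnergy_self_le (A : Finset G) : E[A, A] ≤ #A ^ 3 := by
  rw [addEnergy_self_eq_sum]
  calc _ ≤ ∑ d ∈ A - A, #A * #(diffFiber A d) := by
        refine sum_le_sum fun d _ => ?_
        rw [sq]; exact Nat.mul_le_mul_right _ (card_diffFiber_le A d)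
    _ = #A ^ 3 := by rw [← mul_sum, sum_card_diffFiber]; ring

lemma sum_sq_diffFiber_le (A : Finset G) (T : Finset G) :
    ∑ d ∈ T, #(diffFiber A d) ^ 2 ≤ E[A, A] := by
  rw [addEnergy_self_eq_sum]
  refine sum_le_sum_of_ne_zero fun d _ h => ?_
  have : (diffFiber A d).Nonempty := by
    rw [← card_pos]; exact Nat.pos_of_ne_zero (by rintro h0; simp [h0] at h)
  obtain ⟨a, ha⟩ := this
  rw [diffFiber, mem_filter] at ha
  exact mem_sub.2 ⟨a, ha.1, a - d, ha.2, by simp⟩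

/-- Cauchy-Schwarz for the mixed additive energy. -/
lemma addEnergy_sq_le (A B : Finset G) : E[A, B] ^ 2 ≤ E[A, A] * E[B, B] := by
  rw [addEnergy_eq_sum_diffFiber]
  exact (sum_mul_sq_le_sq_mul_sq _ _ _).trans
    (Nat.mul_le_mul (sum_sq_diffFiber_le A _) (sum_sq_diffFiber_le B _))

lemma card_pairs_le_diffFiber (A T : Finset G) (a b : G) :
    #{d ∈ T | a ∈ diffFiber A d ∧ b ∈ diffFiber A d} ≤ #(diffFiber A (a - b)) := by
  refine card_le_card_of_injOn (fun d => a - d) ?_ ?_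
  · intro d hd
    simp only [coe_filter, Set.mem_ofPred_eq, diffFiber, mem_filter] at hd ⊢
    exact ⟨hd.2.1.2, by simpa using hd.2.2.2⟩
  · intro d _ d' _ h
    simpa using h

/-- A popular difference fibre: if `A` has large energy then some `X = A ∩ (A + d)` is large and
for all but an eighth of the pairs in `X` the difference is popular in `A`. -/
lemma exists_diffFiber_few_unpopular (A : Finset G) (hA : A.Nonempty) (K : ℝ) (hK : 0 < K)
    (hE : (#A : ℝ) ^ 3 / K ≤ E[A, A]) :
    ∃ d, (#A : ℝ) / (2 * K) ≤ #(diffFiber A d) ∧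
      8 * (#{x ∈ diffFiber A d ×ˢ diffFiber A d |
        (#(diffFiber A (x.1 - x.2)) : ℝ) < #A / (32 * K)} : ℝ) ≤ (#(diffFiber A d) : ℝ) ^ 2 := by
  by_contra! hcon
  set N : ℝ := (#A : ℝ) with hN
  have hNpos : 0 < N := by rw [hN]; exact_mod_cast hA.card_pos
  set bad : G → ℕ := fun d => #{x ∈ diffFiber A d ×ˢ diffFiber A d |
        (#(diffFiber A (x.1 - x.2)) : ℝ) < N / (32 * K)} with hbad
  have h1 : ∑ d ∈ A - A, (bad d : ℝ) ≤ N ^ 2 * (N / (32 * K)) := by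
    have e1 : ∑ d ∈ A - A, bad d = ∑ x ∈ A ×ˢ A with
        (#(diffFiber A (x.1 - x.2)) : ℝ) < N / (32 * K),
        #{d ∈ A - A | x.1 ∈ diffFiber A d ∧ x.2 ∈ diffFiber A d} := by
      have := sum_card_bipartiteAbove_eq_sum_card_bipartiteBelow
        (s := A - A) (t := {x ∈ A ×ˢ A | (#(diffFiber A (x.1 - x.2)) : ℝ) < N / (32 * K)})
        (fun d x => x.1 ∈ diffFiber A d ∧ x.2 ∈ diffFiber A d)
      simp only [bipartiteAbove, bipartiteBelow] at this
      rw [← this]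
      refine sum_congr rfl fun d _ => ?_
      simp only [hbad]
      congr 1
      ext x
      have hsub : ∀ y ∈ diffFiber A d, y ∈ A := fun y hy => (mem_filter.1 hy).1
      simp only [mem_filter, mem_product]
      exact ⟨fun h => ⟨⟨⟨hsub _ h.1.1, hsub _ h.1.2⟩, h.2⟩, h.1⟩, fun h => ⟨h.2, h.1.2⟩⟩
    have e2 : (∑ d ∈ A - A, (bad d : ℝ)) = ((∑ d ∈ A - A, bad d : ℕ) : ℝ) := by push_cast; rfl
    rw [e2, e1]
    push_cast
    calc _ ≤ ∑ x ∈ A ×ˢ A with (#(diffFiber A (x.1 - x.2)) : ℝ) < N / (32 * K),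
          (N / (32 * K)) := by
          refine sum_le_sum fun x hx => ?_
          refine le_trans ?_ (mem_filter.1 hx).2.le
          exact_mod_cast card_pairs_le_diffFiber A _ x.1 x.2
      _ ≤ ∑ x ∈ A ×ˢ A, (N / (32 * K)) :=
          sum_le_sum_of_subset_of_nonneg (filter_subset _ _) (fun _ _ _ => by positivity)
      _ = _ := by simp [hN]; left; ring
  have h2 : (∑ d ∈ A - A, (#(diffFiber A d) : ℝ)) = N ^ 2 := by
    rw [hN]; exact_mod_cast sum_card_diffFiber A
  have h3 : (E[A, A] : ℝ) = ∑ d ∈ A - A, (#(diffFiber A d) : ℝ) ^ 2 := by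
    exact_mod_cast addEnergy_self_eq_sum A
  -- small fibres carry at most half of the energy; in each large one more than an eighth of the
  -- pairs would be unpopular
  have h4 : ∀ d, (#(diffFiber A d) : ℝ) ^ 2 ≤
      N / (2 * K) * #(diffFiber A d) + 8 * bad d := by
    intro d
    rcases le_or_gt (N / (2 * K)) (#(diffFiber A d)) with h | h
    · have := hcon d h
      have h0 : 0 ≤ N / (2 * K) * #(diffFiber A d) := by positivity
      linarith
    · have h0 : (0 : ℝ) ≤ #(diffFiber A d) := by positivity
      have h5 : (0 : ℝ) ≤ 8 * bad d := by positivity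
      nlinarith
  have h5 : (E[A, A] : ℝ) ≤ N / (2 * K) * N ^ 2 + 8 * (N ^ 2 * (N / (32 * K))) := by
    rw [h3]
    calc _ ≤ ∑ d ∈ A - A, (N / (2 * K) * #(diffFiber A d) + 8 * (bad d : ℝ)) :=
          sum_le_sum fun d _ => h4 d
      _ = N / (2 * K) * N ^ 2 + 8 * ∑ d ∈ A - A, (bad d : ℝ) := by
          rw [sum_add_distrib, ← mul_sum, ← mul_sum, h2]
      _ ≤ _ := by linarith
  have h6 : N / (2 * K) * N ^ 2 + 8 * (N ^ 2 * (N / (32 * K))) = 3 / 4 * (N ^ 3 / K) := by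
    field_simp; norm_num
  have h7 : 0 < N ^ 3 / K := by positivity
  linarith

/-- Each `b` for which both `a - b` and `a' - b` are popular gives at least `τ ^ 2` representations
`a - a' = (a - b) - (a' - b)`, and distinct `b` give distinct ones. -/
lemma mul_sq_le_card_quadruples (A Y : Finset G) (a a' : G) (τ : ℝ) (hτ : 0 ≤ τ)
    (hY : ∀ b ∈ Y, τ ≤ #(diffFiber A (a - b)) ∧ τ ≤ #(diffFiber A (a' - b))) :
    #Y * τ ^ 2 ≤
      (#{x ∈ (A ×ˢ A) ×ˢ (A ×ˢ A) | (x.1.1 - x.1.2) - (x.2.1 - x.2.2) = a - a'} : ℝ) := by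
  have h1 : #(Y.sigma fun b => diffFiber A (a - b) ×ˢ diffFiber A (a' - b)) ≤
      #{x ∈ (A ×ˢ A) ×ˢ (A ×ˢ A) | (x.1.1 - x.1.2) - (x.2.1 - x.2.2) = a - a'} := by
    refine card_le_card_of_injOn
      (fun x => ((x.2.1, x.2.1 - (a - x.1)), (x.2.2, x.2.2 - (a' - x.1)))) ?_ ?_
    · rintro ⟨b, x, z⟩ h
      simp only [coe_sigma, Set.mem_sigma_iff, mem_coe, mem_product, diffFiber, mem_filter] at h
      simp only [coe_filter, Set.mem_ofPred_eq, mem_product]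
      refine ⟨⟨⟨h.2.1.1, h.2.1.2⟩, h.2.2.1, h.2.2.2⟩, by abel⟩
    · rintro ⟨b, x, z⟩ _ ⟨b', x', z'⟩ _ h
      simp only [Prod.mk.injEq] at h
      obtain ⟨⟨rfl, h2⟩, rfl, h3⟩ := h
      have : b = b' := by simpa using h2
      subst this; rfl
  rw [card_sigma] at h1
  calc #Y * τ ^ 2 = ∑ b ∈ Y, τ ^ 2 := by simp
    _ ≤ ∑ b ∈ Y, (#(diffFiber A (a - b) ×ˢ diffFiber A (a' - b)) : ℝ) := by
        refine sum_le_sum fun b hb => ?_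
        rw [card_product]; push_cast
        rw [sq]
        exact mul_le_mul (hY b hb).1 (hY b hb).2 hτ (by positivity)
    _ ≤ _ := by exact_mod_cast h1

/-- The **Balog-Szemerédi-Gowers theorem**, by Schoen's argument: `B` consists of the elements of a
fibre `A ∩ (A + d)` that form an unpopular difference with at most a quarter of the fibre, so any
two elements of `B` share half of the fibre as popular partners. -/
theorem balog_szemeredi_gowers (A : Finset G) (hA : A.Nonempty) (K : ℝ) (hK : 0 < K)
    (hE : (#A : ℝ) ^ 3 / K ≤ E[A, A]) :
    ∃ B ⊆ A, (#A : ℝ) ≤ 4 * K * #B ∧ (#(B - B) : ℝ) ≤ 4096 * K ^ 3 * #A := by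
  obtain ⟨d, hd1, hd2⟩ := exists_diffFiber_few_unpopular A hA K hK hE
  set N : ℝ := (#A : ℝ) with hN
  have hNpos : 0 < N := by rw [hN]; exact_mod_cast hA.card_pos
  set X := diffFiber A d with hX
  have hXpos : 0 < (#X : ℝ) := lt_of_lt_of_le (by positivity) hd1
  set nb : G → Finset G := fun a => {b ∈ X | (#(diffFiber A (a - b)) : ℝ) < N / (32 * K)} with hnb
  set B : Finset G := {a ∈ X | 4 * (#(nb a) : ℝ) ≤ #X} with hB
  have hXA : X ⊆ A := filter_subset _ _
  have hBX : B ⊆ X := filter_subset _ _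
  have hsum : (#{x ∈ X ×ˢ X | (#(diffFiber A (x.1 - x.2)) : ℝ) < N / (32 * K)} : ℝ)
      = ∑ a ∈ X, (#(nb a) : ℝ) := by
    rw [← Nat.cast_sum]; congr 1
    rw [card_filter, sum_product]
    refine sum_congr rfl fun a _ => ?_
    rw [hnb, card_filter]
  have hBcard : (#X : ℝ) ≤ 2 * #B := by
    have h1 : (#(X \ B) : ℝ) * #X ≤ 4 * ∑ a ∈ X, (#(nb a) : ℝ) := by
      calc (#(X \ B) : ℝ) * #X = ∑ a ∈ X \ B, (#X : ℝ) := by simp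
        _ ≤ ∑ a ∈ X \ B, 4 * (#(nb a) : ℝ) := by
            refine sum_le_sum fun a ha => ?_
            simp only [hB, mem_sdiff, mem_filter, not_and, not_le] at ha
            exact (ha.2 ha.1).le
        _ ≤ ∑ a ∈ X, 4 * (#(nb a) : ℝ) :=
            sum_le_sum_of_subset_of_nonneg sdiff_subset (fun _ _ _ => by positivity)
        _ = _ := by rw [mul_sum]
    rw [hsum] at hd2
    have h2 : (#(X \ B) : ℝ) = #X - #B := by
      rw [card_sdiff_of_subset hBX, Nat.cast_sub (card_le_card hBX)]
    rw [h2] at h1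
    nlinarith
  refine ⟨B, hBX.trans hXA, ?_, ?_⟩
  · rw [div_le_iff₀ (by positivity)] at hd1
    nlinarith
  · have key : ∀ e ∈ B - B, (#X : ℝ) / 2 * (N / (32 * K)) ^ 2 ≤
        #{x ∈ (A ×ˢ A) ×ˢ (A ×ˢ A) | (x.1.1 - x.1.2) - (x.2.1 - x.2.2) = e} := by
      intro e he
      obtain ⟨a, ha, a', ha', rfl⟩ := mem_sub.1 he
      refine le_trans ?_ (mul_sq_le_card_quadruples A (X \ (nb a ∪ nb a')) a a' (N / (32 * K))
        (by positivity) ?_)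
      · refine mul_le_mul_of_nonneg_right ?_ (by positivity)
        have h1 : (#X : ℝ) ≤ #(X \ (nb a ∪ nb a')) + (#(nb a) + #(nb a')) := by
          have h3 := card_le_card_sdiff_add_card (s := X) (t := nb a ∪ nb a')
          have h4 := card_union_le (nb a) (nb a')
          have h5 : #X ≤ #(X \ (nb a ∪ nb a')) + (#(nb a) + #(nb a')) := by omega
          exact_mod_cast h5
        have h3 := (mem_filter.1 ha).2
        have h4 := (mem_filter.1 ha').2
        linarith
      · intro b hb
        simp only [hnb, mem_sdiff, mem_union, mem_filter, not_or, not_and, not_lt] at hb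
        exact ⟨hb.2.1 hb.1, hb.2.2 hb.1⟩
    have h1 : (#(B - B) : ℝ) * ((#X : ℝ) / 2 * (N / (32 * K)) ^ 2) ≤ N ^ 4 := by
      calc _ = ∑ e ∈ B - B, ((#X : ℝ) / 2 * (N / (32 * K)) ^ 2) := by simp
        _ ≤ ∑ e ∈ B - B,
          (#{x ∈ (A ×ˢ A) ×ˢ (A ×ˢ A) | (x.1.1 - x.1.2) - (x.2.1 - x.2.2) = e} : ℝ) :=
            sum_le_sum key
        _ ≤ (#((A ×ˢ A) ×ˢ (A ×ˢ A)) : ℝ) := by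
            rw [← Nat.cast_sum]
            rw [sum_card_fiberwise_eq_card_filter]
            exact_mod_cast card_filter_le _ _
        _ = N ^ 4 := by simp only [card_product]; push_cast; ring
    have h2 : N / (4 * K) * (N / (32 * K)) ^ 2 ≤ (#X : ℝ) / 2 * (N / (32 * K)) ^ 2 := by
      refine mul_le_mul_of_nonneg_right ?_ (by positivity)
      have : N / (4 * K) = N / (2 * K) / 2 := by field_simp; norm_num
      linarith
    have h3 : (#(B - B) : ℝ) * (N / (4 * K) * (N / (32 * K)) ^ 2) ≤ N ^ 4 :=
      (mul_le_mul_of_nonneg_left h2 (by positivity)).trans h1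
    have h4 : N ^ 4 = 4096 * K ^ 3 * N * (N / (4 * K) * (N / (32 * K)) ^ 2) := by
      field_simp; norm_num
    rw [h4] at h3
    exact le_of_mul_le_mul_right h3 (by positivity)

/-- The sumset form of the Balog-Szemerédi-Gowers theorem, via the Plünnecke-Ruzsa inequality. -/
theorem balog_szemeredi_gowers_add (A : Finset G) (hA : A.Nonempty) (K : ℝ) (hK : 0 < K)
    (hE : (#A : ℝ) ^ 3 / K ≤ E[A, A]) :
    ∃ B ⊆ A, (#A : ℝ) ≤ 4 * K * #B ∧ (#(B + B) : ℝ) ≤ 2 ^ 26 * K ^ 7 * #A := by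
  obtain ⟨B, hBA, h1, h2⟩ := balog_szemeredi_gowers A hA K hK hE
  refine ⟨B, hBA, h1, ?_⟩
  have hNpos : 0 < (#A : ℝ) := by exact_mod_cast hA.card_pos
  have hBpos : 0 < (#B : ℝ) := by
    by_contra h
    nlinarith [mul_pos (show (0 : ℝ) < 4 by norm_num) hK]
  have hB : B.Nonempty := by rw [← card_pos]; exact_mod_cast hBpos
  have h3 := pluennecke_ruzsa_inequality_nsmul_sub hB B 2
  rw [two_nsmul] at h3
  have h4 : (#(B + B) : ℝ) ≤ (#(B - B) / #B : ℝ) ^ 2 * #B := by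
    have := (NNRat.cast_le (K := ℝ)).2 h3
    push_cast at this
    exact this
  have h5 : (#(B - B) / #B : ℝ) ^ 2 * #B = (#(B - B) : ℝ) ^ 2 / #B := by field_simp
  rw [h5, le_div_iff₀ hBpos] at h4
  have h6 : (#(B - B) : ℝ) ^ 2 ≤ (4096 * K ^ 3 * #A) ^ 2 := by gcongr
  have h7 : (#(B + B) : ℝ) * #A ≤ #(B + B) * (4 * K * #B) := by gcongr
  have h8 : (#(B + B) : ℝ) * #A ≤ 2 ^ 26 * K ^ 7 * #A * #A := by nlinarith
  exact le_of_mul_le_mul_right h8 hNpos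

end BalogSzemerediGowers

/-! ### Solymosi's inequality -/

/-- Solymosi's argument for a chain of slopes. The points of `D × D`, `D = exp L`, on the line
through the origin of slope `exp d` are indexed by `diffFiber L d`. Sums of points on two
consecutive lines lie strictly between these lines, so they are all distinct. -/
lemma sum_card_consecutive_le (L : Finset ℝ) {k : ℕ} (f : Fin (k + 1) → ℝ) (hf : StrictMono f) :
    ∑ i : Fin k, #(diffFiber L (f i.castSucc)) * #(diffFiber L (f i.succ)) ≤
      #(L.image Real.exp + L.image Real.exp) ^ 2 := by
  set D := L.image Real.exp with hD
  simp_rw [← card_product]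
  rw [← card_sigma, sq, ← card_product]
  have hmul : ∀ (x d : ℝ), Real.exp x = Real.exp d * Real.exp (x - d) := by
    intro x d; rw [← Real.exp_add]; congr 1; ring
  have hlow : ∀ (i : Fin k) (x y : ℝ), Real.exp (f i.castSucc) *
      (Real.exp (x - f i.castSucc) + Real.exp (y - f i.succ)) < Real.exp x + Real.exp y := by
    intro i x y
    rw [mul_add, ← hmul, hmul y (f i.succ)]
    have : Real.exp (f i.castSucc) < Real.exp (f i.succ) :=
      Real.exp_lt_exp.2 (hf Fin.castSucc_lt_succ)
    have h2 := mul_lt_mul_of_pos_right this (Real.exp_pos (y - f i.succ))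
    linarith
  have hhigh : ∀ (i : Fin k) (x y : ℝ), Real.exp x + Real.exp y < Real.exp (f i.succ) *
      (Real.exp (x - f i.castSucc) + Real.exp (y - f i.succ)) := by
    intro i x y
    rw [mul_add, ← hmul y, hmul x (f i.castSucc)]
    have : Real.exp (f i.castSucc) < Real.exp (f i.succ) :=
      Real.exp_lt_exp.2 (hf Fin.castSucc_lt_succ)
    have h2 := mul_lt_mul_of_pos_right this (Real.exp_pos (x - f i.castSucc))
    linarith
  have hlt : ∀ (i j : Fin k) (x y x' y' : ℝ), i < j →
      Real.exp (x - f i.castSucc) + Real.exp (y - f i.succ) =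
        Real.exp (x' - f j.castSucc) + Real.exp (y' - f j.succ) →
      Real.exp x + Real.exp y ≠ Real.exp x' + Real.exp y' := by
    intro i j x y x' y' hij h1 h2
    have a1 := hhigh i x y
    have a2 := hlow j x' y'
    rw [← h1, ← h2] at a2
    have : Real.exp (f i.succ) ≤ Real.exp (f j.castSucc) := by
      rw [Real.exp_le_exp]
      exact hf.monotone (by rw [Fin.le_def]; simpa using hij)
    have h3 := mul_le_mul_of_nonneg_right this
      (add_pos (Real.exp_pos (x - f i.castSucc)) (Real.exp_pos (y - f i.succ))).le
    linarith
  refine card_le_card_of_injOn (fun p =>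
    (Real.exp (p.2.1 - f p.1.castSucc) + Real.exp (p.2.2 - f p.1.succ),
      Real.exp p.2.1 + Real.exp p.2.2)) ?_ ?_
  · rintro ⟨i, x, y⟩ h
    simp only [coe_sigma, Set.mem_sigma_iff, mem_coe, mem_product, diffFiber, mem_filter] at h
    obtain ⟨-, ⟨hx, hx'⟩, hy, hy'⟩ := h
    simp only [mem_coe, mem_product]
    exact ⟨add_mem_add (mem_image_of_mem _ hx') (mem_image_of_mem _ hy'),
      add_mem_add (mem_image_of_mem _ hx) (mem_image_of_mem _ hy)⟩
  · rintro ⟨i, x, y⟩ _ ⟨j, x', y'⟩ _ h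
    simp only [Prod.mk.injEq] at h
    obtain ⟨h1, h2⟩ := h
    rcases lt_trichotomy i j with hij | rfl | hij
    · exact absurd h2 (hlt i j x y x' y' hij h1)
    · have hab : Real.exp (f i.castSucc) < Real.exp (f i.succ) :=
        Real.exp_lt_exp.2 (hf Fin.castSucc_lt_succ)
      rw [hmul x (f i.castSucc), hmul y (f i.succ), hmul x' (f i.castSucc),
        hmul y' (f i.succ)] at h2
      have h3 : (Real.exp (f i.succ) - Real.exp (f i.castSucc)) *
          (Real.exp (y - f i.succ) - Real.exp (y' - f i.succ)) = 0 := by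
        linear_combination h2 - Real.exp (f i.castSucc) * h1
      have h4 : Real.exp (y - f i.succ) = Real.exp (y' - f i.succ) := by
        rcases mul_eq_zero.1 h3 with h | h <;> linarith
      have h5 : Real.exp (x - f i.castSucc) = Real.exp (x' - f i.castSucc) := by linarith
      have h6 := Real.exp_injective h4
      have h7 := Real.exp_injective h5
      have : x = x' := by linarith
      have : y = y' := by linarith
      subst_vars; rfl
    · exact absurd h2.symm (hlt j i x' y' x y hij h1.symm)

/-- The chain of all slopes with at least `τ` points; the factor `2` absorbs the one link by which
the chain is shorter than the number of slopes, since `τ ≤ |D| ≤ |D + D|`. -/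
lemma card_popular_mul_sq_le (L : Finset ℝ) (τ : ℕ) :
    #{d ∈ L - L | τ ≤ #(diffFiber L d)} * τ ^ 2 ≤
      2 * #(L.image Real.exp + L.image Real.exp) ^ 2 := by
  set T := {d ∈ L - L | τ ≤ #(diffFiber L d)} with hT
  rcases T.eq_empty_or_nonempty with h0 | hne
  · simp [h0]
  obtain ⟨k, hk⟩ : ∃ k, #T = k + 1 := ⟨#T - 1, by have := hne.card_pos; omega⟩
  set D := L.image Real.exp with hD
  have hmem : ∀ i, τ ≤ #(diffFiber L (T.orderEmbOfFin hk i)) := fun i =>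
    (mem_filter.1 (T.orderEmbOfFin_mem hk i)).2
  have h1 : k * τ ^ 2 ≤ #(D + D) ^ 2 := by
    refine le_trans ?_ (sum_card_consecutive_le L (T.orderEmbOfFin hk)
      (T.orderEmbOfFin hk).strictMono)
    calc k * τ ^ 2 = ∑ i : Fin k, τ ^ 2 := by simp
      _ ≤ _ := by
        refine sum_le_sum fun i _ => ?_
        rw [sq]
        exact Nat.mul_le_mul (hmem _) (hmem _)
  have h2 : τ ≤ #(D + D) := by
    calc τ ≤ #L := (hmem 0).trans (card_diffFiber_le _ _)
      _ = #D := (card_image_of_injective _ Real.exp_injective).symm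
      _ ≤ #(D + D) := by
        rcases D.eq_empty_or_nonempty with h | h
        · simp [h]
        · exact card_le_card_add_left h
  have h3 : τ ^ 2 ≤ #(D + D) ^ 2 := Nat.pow_le_pow_left h2 2
  rw [hk]; nlinarith

/-- **Solymosi's inequality**: the multiplicative energy of `D = exp L` (the additive energy
of `L`) is at most `4 |D + D|² (1 + log |D|)`. -/
theorem addEnergy_le_card_exp_add_exp (L : Finset ℝ) :
    (E[L, L] : ℝ) ≤
      4 * (#(L.image Real.exp + L.image Real.exp) : ℝ) ^ 2 * (1 + Real.log #L) := by
  set S : ℝ := (#(L.image Real.exp + L.image Real.exp) : ℝ) with hS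
  -- layer-cake summation of `r ^ 2 ≤ ∑_{t < r} 2 (t + 1)`
  have h1 : E[L, L] ≤ ∑ t ∈ range #L, 2 * (t + 1) * #{d ∈ L - L | t + 1 ≤ #(diffFiber L d)} := by
    rw [addEnergy_self_eq_sum]
    calc _ ≤ ∑ d ∈ L - L, ∑ t ∈ range #L,
          (if t + 1 ≤ #(diffFiber L d) then 2 * (t + 1) else 0) := by
          refine sum_le_sum fun d _ => ?_
          rw [← sum_filter]
          have : {t ∈ range #L | t + 1 ≤ #(diffFiber L d)} = range #(diffFiber L d) := by
            ext t
            have := card_diffFiber_le L d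
            simp only [mem_filter, mem_range]; omega
          rw [this]
          generalize #(diffFiber L d) = r
          induction r with
          | zero => simp
          | succ r ih => rw [sum_range_succ]; nlinarith
      _ = _ := by
          rw [sum_comm]
          refine sum_congr rfl fun t _ => ?_
          rw [← sum_filter, sum_const, smul_eq_mul, mul_comm]
  have h2 : (E[L, L] : ℝ) ≤ ∑ t ∈ range #L, 4 * S ^ 2 * ((t + 1 : ℕ) : ℝ)⁻¹ := by
    refine (Nat.cast_le (α := ℝ).2 h1).trans ?_
    push_cast
    refine sum_le_sum fun t _ => ?_
    have h3 : (#{d ∈ L - L | t + 1 ≤ #(diffFiber L d)} : ℝ) * ((t : ℝ) + 1) ^ 2 ≤ 2 * S ^ 2 := by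
      rw [hS]
      exact_mod_cast card_popular_mul_sq_le L (t + 1)
    have h4 : (0 : ℝ) < t + 1 := by positivity
    rw [← div_eq_mul_inv, le_div_iff₀ h4]
    nlinarith
  refine h2.trans ?_
  rw [← mul_sum]
  refine mul_le_mul_of_nonneg_left ?_ (by positivity)
  have h5 := harmonic_le_one_add_log #L
  rw [harmonic] at h5
  push_cast at h5 ⊢
  exact h5

/-! ### A sum-product dichotomy for three summands -/

lemma card_triple_sq_le (X Y Z : Finset ℝ) (n : ℝ) :
    #{x ∈ Z ×ˢ (X ×ˢ Y) | x.1 + (x.2.1 + x.2.2) = n} ^ 2 ≤ #Z * E[X, Y] := by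
  have h1 : #{x ∈ Z ×ˢ (X ×ˢ Y) | x.1 + (x.2.1 + x.2.2) = n} ≤
      #{xy ∈ X ×ˢ Y | xy.1 + xy.2 ∈ Z.image (fun z => n - z)} := by
    refine card_le_card_of_injOn (fun x => x.2) ?_ ?_
    · rintro ⟨z, x, y⟩ h
      simp only [coe_filter, Set.mem_ofPred_eq, mem_product, mem_image] at h ⊢
      exact ⟨h.1.2, z, h.1.1, by linarith [h.2]⟩
    · rintro ⟨z, x, y⟩ h ⟨z', x', y'⟩ h' e
      simp only [coe_filter, Set.mem_ofPred_eq] at h h' e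
      cases e
      have : z = z' := by linarith [h.2, h'.2]
      subst this; rfl
  calc _ ≤ _ := Nat.pow_le_pow_left h1 2
    _ ≤ _ := card_sq_le_card_mul_addEnergy _ _ _
    _ ≤ _ := Nat.mul_le_mul_right _ card_image_le

/-- The number of ordered representations of `n` as a sum of three elements of `X`. -/
noncomputable def tripleRep (X : Finset ℝ) (n : ℝ) : ℕ :=
  #{x ∈ X ×ˢ (X ×ˢ X) | x.1 + (x.2.1 + x.2.2) = n}

lemma tripleRep_sq_le (X : Finset ℝ) (n : ℝ) : tripleRep X n ^ 2 ≤ #X * E[X, X] :=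
  card_triple_sq_le X X X n

lemma tripleRep_biUnion_le (F : Finset (Finset ℝ)) (n : ℝ) :
    tripleRep (F.biUnion id) n ≤ ∑ D ∈ F,
      #{x ∈ F.biUnion id ×ˢ (D ×ˢ F.biUnion id) | x.1 + (x.2.1 + x.2.2) = n} := by
  refine le_trans (card_le_card ?_) card_biUnion_le
  rintro ⟨z, x, y⟩ h
  simp only [mem_filter, mem_product, mem_biUnion, id_eq] at h ⊢
  obtain ⟨⟨hz, ⟨D, hD, hx⟩, hy⟩, e⟩ := h
  exact ⟨D, hD, ⟨hz, hx, hy⟩, e⟩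

/-- It is enough that one of the three summands ranges over a set of small energy; this avoids a
bound for the energy of a union. -/
lemma card_triple_pow_four_le (D U : Finset ℝ) (n : ℝ) :
    #{x ∈ U ×ˢ (D ×ˢ U) | x.1 + (x.2.1 + x.2.2) = n} ^ 4 ≤ #U ^ 5 * E[D, D] := by
  calc _ = (#{x ∈ U ×ˢ (D ×ˢ U) | x.1 + (x.2.1 + x.2.2) = n} ^ 2) ^ 2 := by ring
    _ ≤ (#U * E[D, U]) ^ 2 := Nat.pow_le_pow_left (card_triple_sq_le D U U n) 2
    _ = #U ^ 2 * E[D, U] ^ 2 := by ring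
    _ ≤ #U ^ 2 * (E[D, D] * #U ^ 3) := by
        refine Nat.mul_le_mul_left _ ((addEnergy_sq_le D U).trans ?_)
        exact Nat.mul_le_mul_left _ (addEnergy_self_le U)
    _ = _ := by ring

/-- A set `R` such that `exp R` has large additive energy contains a large subset of small
multiplicative energy. -/
lemma exists_subset_addEnergy_le (R : Finset ℝ) (hR : R.Nonempty) (K : ℝ) (hK : 0 < K)
    (hE : (#R : ℝ) ^ 3 / K ≤ E[R.image Real.exp, R.image Real.exp]) :
    ∃ D ⊆ R, (#R : ℝ) ≤ 4 * K * #D ∧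
      (E[D, D] : ℝ) ≤ 4 * (2 ^ 26 * K ^ 7 * #R) ^ 2 * (1 + Real.log #R) := by
  have hc : #(R.image Real.exp) = #R := card_image_of_injective _ Real.exp_injective
  obtain ⟨B, hB, h1, h2⟩ := balog_szemeredi_gowers_add (R.image Real.exp) (hR.image _) K hK
    (by rwa [hc])
  obtain ⟨D, hD, rfl⟩ := subset_image_iff.1 hB
  rw [hc] at h1 h2
  rw [card_image_of_injective _ Real.exp_injective] at h1
  have hDR : D ⊆ R := by exact_mod_cast hD
  refine ⟨D, hDR, h1, (addEnergy_le_card_exp_add_exp D).trans ?_⟩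
  have hpos : 0 < #D := by
    have : 0 < (#R : ℝ) := by exact_mod_cast hR.card_pos
    by_contra h0
    have : (#D : ℝ) = 0 := by exact_mod_cast (by omega : #D = 0)
    rw [this] at h1; linarith
  have h3 : Real.log #D ≤ Real.log #R :=
    Real.log_le_log (by exact_mod_cast hpos) (by exact_mod_cast card_le_card hDR)
  have h4 : 0 ≤ Real.log #D := Real.log_natCast_nonneg _
  gcongr

/-- A maximal family of pairwise disjoint subsets with property `p`. -/
lemma exists_maximal_disjoint_family (L : Finset ℝ) (p : Finset ℝ → Prop) :
    ∃ F : Finset (Finset ℝ), (∀ D ∈ F, D ⊆ L ∧ p D) ∧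
      (F : Set (Finset ℝ)).PairwiseDisjoint id ∧
      ∀ D ⊆ L, D.Nonempty → p D → ¬ Disjoint D (F.biUnion id) := by
  classical
  set 𝒮 : Finset (Finset (Finset ℝ)) := {F ∈ L.powerset.powerset |
    (∀ D ∈ F, p D) ∧ (F : Set (Finset ℝ)).PairwiseDisjoint id} with h𝒮
  obtain ⟨F, hF, hmax⟩ := exists_max_image 𝒮 card ⟨∅, by simp [h𝒮]⟩
  simp only [h𝒮, mem_filter, mem_powerset] at hF
  refine ⟨F, fun D hD => ⟨mem_powerset.1 (hF.1 hD), hF.2.1 D hD⟩, hF.2.2, ?_⟩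
  intro D hDL hne hp hdisj
  have hnot : D ∉ F := by
    intro hD
    have h1 : D ⊆ F.biUnion id := subset_biUnion_of_mem id hD
    exact hne.ne_empty (disjoint_self.1 (hdisj.mono_right h1))
  have hmem : insert D F ∈ 𝒮 := by
    simp only [h𝒮, mem_filter, mem_powerset]
    refine ⟨insert_subset (mem_powerset.2 hDL) hF.1, ?_, ?_⟩
    · intro E hE
      rcases mem_insert.1 hE with rfl | hE
      · exact hp
      · exact hF.2.1 E hE
    · rw [coe_insert]
      refine hF.2.2.insert fun E hE _ => ?_
      exact hdisj.mono_right (subset_biUnion_of_mem id hE)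
  have := hmax _ hmem
  rw [card_insert_of_notMem hnot] at this
  omega

/-- A finite set `exp L` of positive reals contains a subset of at least half its size for which
either the sums or the products of three elements have a power saving. A maximal disjoint family of
large subsets of small multiplicative energy either covers half of the set, which settles the
products, or by Balog-Szemerédi-Gowers leaves a remainder of small additive energy.
The parameter is `K = |L| ^ (1 / 21)`; all quantities are written as powers of
`t = |L| ^ (1 / 42)`. -/
theorem exists_subset_tripleRep_le (L : Finset ℝ) :
    ∃ L' ⊆ L, #L ≤ 2 * #L' ∧
      ((∀ n, (tripleRep (L'.image Real.exp) n : ℝ) ≤ 2 ^ 20 * (#L' : ℝ) ^ (83 / 42 : ℝ)) ∨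
        (∀ n, (tripleRep L' n : ℝ) ≤ 2 ^ 20 * (#L' : ℝ) ^ (83 / 42 : ℝ))) := by
  rcases L.eq_empty_or_nonempty with rfl | hL
  · refine ⟨∅, by simp, by simp, Or.inr fun n => ?_⟩
    simp [tripleRep]
  have hM0 : 0 < (#L : ℝ) := by exact_mod_cast hL.card_pos
  have hM1 : 1 ≤ (#L : ℝ) := by exact_mod_cast hL.card_pos
  obtain ⟨t, ht1, htM⟩ : ∃ t : ℝ, 1 ≤ t ∧ (#L : ℝ) = t ^ 42 := by
    refine ⟨(#L : ℝ) ^ (1 / 42 : ℝ), Real.one_le_rpow hM1 (by norm_num), ?_⟩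
    rw [← Real.rpow_natCast, ← Real.rpow_mul hM0.le]; norm_num
  have ht0 : 0 < t := by linarith
  have hlog : 1 + Real.log #L ≤ 22 * t ^ 2 := by
    have h1 := Real.log_le_rpow_div ht0.le (show (0 : ℝ) < 2 by norm_num)
    rw [htM, Real.log_pow]
    have h2 : t ^ (2 : ℝ) = t ^ 2 := by exact_mod_cast Real.rpow_natCast t 2
    rw [h2] at h1
    push_cast
    have h3 : 1 ≤ t ^ 2 := one_le_pow₀ ht1
    linarith
  -- it is enough to bound in terms of the larger set
  have hfin : ∀ (L' : Finset ℝ) (r : ℕ), #L ≤ 2 * #L' → (r : ℝ) ≤ 2 ^ 18 * t ^ 83 →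
      (r : ℝ) ≤ 2 ^ 20 * (#L' : ℝ) ^ (83 / 42 : ℝ) := by
    intro L' r h1 h2
    have h1' : (#L : ℝ) ≤ 2 * #L' := by exact_mod_cast h1
    have h3 : t ^ 83 = (#L : ℝ) ^ (83 / 42 : ℝ) := by
      rw [htM, ← Real.rpow_natCast, ← Real.rpow_natCast, ← Real.rpow_mul ht0.le]; norm_num
    have h4 : (#L : ℝ) ^ (83 / 42 : ℝ) ≤ (2 * #L') ^ (83 / 42 : ℝ) :=
      Real.rpow_le_rpow hM0.le h1' (by norm_num)
    rw [Real.mul_rpow (by norm_num) (by positivity)] at h4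
    have h5 : (2 : ℝ) ^ (83 / 42 : ℝ) ≤ 4 := by
      calc (2 : ℝ) ^ (83 / 42 : ℝ) ≤ 2 ^ (2 : ℝ) :=
            Real.rpow_le_rpow_of_exponent_le (by norm_num) (by norm_num)
        _ = 4 := by norm_num
    have h6 : 0 ≤ (#L' : ℝ) ^ (83 / 42 : ℝ) := by positivity
    nlinarith
  set K : ℝ := t ^ 2 with hK
  have hK0 : 0 < K := by positivity
  set W : ℝ := 4 * (2 ^ 26 * K ^ 7 * #L) ^ 2 * (1 + Real.log #L) with hW
  obtain ⟨F, hF1, hF2, hF3⟩ := exists_maximal_disjoint_family L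
    (fun D => (#L : ℝ) ≤ 8 * K * #D ∧ (E[D, D] : ℝ) ≤ W)
  set U := F.biUnion id with hU
  have hUL : U ⊆ L := biUnion_subset.2 fun D hD => (hF1 D hD).1
  have hUc : (#U : ℝ) ≤ #L := by exact_mod_cast card_le_card hUL
  rcases le_or_gt #L (2 * #U) with hcase | hcase
  · refine ⟨U, hUL, hcase, Or.inr fun n => hfin U _ hcase ?_⟩
    have hFc : (#F : ℝ) ≤ 8 * K := by
      have h1 : (#F : ℝ) * #L ≤ 8 * K * #L := by
        calc (#F : ℝ) * #L = ∑ D ∈ F, (#L : ℝ) := by simp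
          _ ≤ ∑ D ∈ F, 8 * K * (#D : ℝ) := sum_le_sum fun D hD => (hF1 D hD).2.1
          _ = 8 * K * (#U : ℝ) := by
              rw [← mul_sum, hU, card_biUnion hF2]; push_cast; rfl
          _ ≤ _ := by gcongr
      exact le_of_mul_le_mul_right h1 hM0
    have hWle : W ≤ 2 ^ 59 * t ^ 114 := by
      rw [hW, htM] at *
      calc _ ≤ 4 * (2 ^ 26 * K ^ 7 * t ^ 42) ^ 2 * (22 * t ^ 2) := by gcongr
        _ = 2 ^ 54 * 22 * t ^ 114 := by rw [hK]; ring
        _ ≤ _ := by gcongr; norm_num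
    have hpiece : ∀ D ∈ F, (#{x ∈ U ×ˢ (D ×ˢ U) | x.1 + (x.2.1 + x.2.2) = n} : ℝ) ≤
        2 ^ 15 * t ^ 81 := by
      intro D hD
      have h1 : (#{x ∈ U ×ˢ (D ×ˢ U) | x.1 + (x.2.1 + x.2.2) = n} : ℝ) ^ 4 ≤
          (#U : ℝ) ^ 5 * E[D, D] := by exact_mod_cast card_triple_pow_four_le D U n
      refine le_of_pow_le_pow_left₀ (n := 4) (by norm_num) (by positivity) (h1.trans ?_)
      calc (#U : ℝ) ^ 5 * E[D, D] ≤ (t ^ 42) ^ 5 * (2 ^ 59 * t ^ 114) := by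
            refine mul_le_mul ?_ ((hF1 D hD).2.2.trans hWle) (by positivity) (by positivity)
            gcongr; rw [← htM]; exact hUc
        _ = 2 ^ 59 * t ^ 324 := by ring
        _ ≤ 2 ^ 60 * t ^ 324 := by gcongr <;> norm_num
        _ = _ := by ring
    calc (tripleRep U n : ℝ) ≤ ∑ D ∈ F,
          (#{x ∈ U ×ˢ (D ×ˢ U) | x.1 + (x.2.1 + x.2.2) = n} : ℝ) := by
            exact_mod_cast tripleRep_biUnion_le F n
      _ ≤ ∑ D ∈ F, 2 ^ 15 * t ^ 81 := sum_le_sum hpiece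
      _ = #F * (2 ^ 15 * t ^ 81) := by simp
      _ ≤ 8 * K * (2 ^ 15 * t ^ 81) := by gcongr
      _ = _ := by rw [hK]; ring
  · set R := L \ U with hR
    have hRc : #R + #U = #L := card_sdiff_add_card_eq_card hUL
    have hR2 : #L ≤ 2 * #R := by omega
    have hRne : R.Nonempty := by rw [← card_pos]; have := hL.card_pos; omega
    have hRL : (#R : ℝ) ≤ #L := by exact_mod_cast card_le_card sdiff_subset
    have hR0 : 0 < (#R : ℝ) := by exact_mod_cast hRne.card_pos
    have hEn : (E[R.image Real.exp, R.image Real.exp] : ℝ) < (#R : ℝ) ^ 3 / K := by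
      by_contra! hE
      obtain ⟨D, hDR, h1, h2⟩ := exists_subset_addEnergy_le R hRne K hK0 hE
      have hR2' : (#L : ℝ) ≤ 2 * #R := by exact_mod_cast hR2
      have hDne : D.Nonempty := by
        by_contra h
        rw [not_nonempty_iff_eq_empty] at h
        rw [h] at h1; simp at h1; exact hRne.ne_empty h1
      refine hF3 D (hDR.trans sdiff_subset) hDne ⟨by nlinarith, h2.trans ?_⟩
        (disjoint_of_subset_left hDR sdiff_disjoint)
      have h3 : 0 ≤ Real.log #R := Real.log_natCast_nonneg _
      rw [hW]; gcongr
    refine ⟨R, sdiff_subset, hR2, Or.inl fun n => hfin R _ hR2 ?_⟩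
    have hc : #(R.image Real.exp) = #R := card_image_of_injective _ Real.exp_injective
    have h1 : (tripleRep (R.image Real.exp) n : ℝ) ^ 2 ≤
        #R * E[R.image Real.exp, R.image Real.exp] := by
      have := tripleRep_sq_le (R.image Real.exp) n
      rw [hc] at this; exact_mod_cast this
    have h2 : (tripleRep (R.image Real.exp) n : ℝ) ≤ t ^ 83 := by
      refine le_of_pow_le_pow_left₀ (n := 2) (by norm_num) (by positivity) (h1.trans ?_)
      calc (#R : ℝ) * E[R.image Real.exp, R.image Real.exp] ≤ #R * ((#R : ℝ) ^ 3 / K) := by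
            gcongr
        _ = (#R : ℝ) ^ 4 / K := by ring
        _ ≤ (t ^ 42) ^ 4 / K := by gcongr; rw [← htM]; exact hRL
        _ = _ := by rw [hK]; field_simp
    have h3 : 0 < t ^ 83 := by positivity
    linarith

/-! ### Subsets of given sum -/

lemma card_powersetCard_three_le (X : Finset ℝ) (n : ℝ) :
    #{T ∈ X.powersetCard 3 | ∑ x ∈ T, x = n} ≤ tripleRep X n := by
  classical
  refine card_le_card_of_surjOn (fun x => {x.1, x.2.1, x.2.2}) ?_
  intro T hT
  simp only [coe_filter, Set.mem_ofPred_eq, mem_powersetCard] at hT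
  obtain ⟨⟨hTX, hT3⟩, hs⟩ := hT
  obtain ⟨x, y, z, hxy, hxz, hyz, rfl⟩ := card_eq_three.1 hT3
  refine ⟨(x, y, z), ?_, rfl⟩
  simp only [coe_filter, Set.mem_ofPred_eq, mem_product]
  rw [sum_insert (by simp [hxy, hxz]), sum_pair hyz] at hs
  exact ⟨⟨hTX (by simp), hTX (by simp), hTX (by simp)⟩, hs⟩

lemma card_powersetCard_succ_le (X : Finset ℝ) (k : ℕ) (Q : ℕ)
    (hQ : ∀ n, #{T ∈ X.powersetCard k | ∑ x ∈ T, x = n} ≤ Q) (n : ℝ) :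
    #{T ∈ X.powersetCard (k + 1) | ∑ x ∈ T, x = n} ≤ #X * Q := by
  classical
  have h1 : #{T ∈ X.powersetCard (k + 1) | ∑ x ∈ T, x = n} ≤
      #(X.sigma fun x => {T ∈ X.powersetCard k | ∑ y ∈ T, y = n - x}) := by
    refine card_le_card_of_surjOn (fun p => insert p.1 p.2) ?_
    intro T hT
    simp only [coe_filter, Set.mem_ofPred_eq, mem_powersetCard] at hT
    obtain ⟨⟨hTX, hTk⟩, hs⟩ := hT
    obtain ⟨x, hx⟩ : T.Nonempty := by rw [← card_pos]; omega
    refine ⟨⟨x, T.erase x⟩, ?_, insert_erase hx⟩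
    simp only [coe_sigma, Set.mem_sigma_iff, mem_coe, mem_filter, mem_powersetCard]
    refine ⟨hTX hx, ⟨(erase_subset _ _).trans hTX, by rw [card_erase_of_mem hx]; omega⟩, ?_⟩
    rw [← hs, ← add_sum_erase _ _ hx]; ring
  refine h1.trans ?_
  rw [card_sigma, ← smul_eq_mul]
  exact sum_le_card_nsmul _ _ _ fun x _ => hQ _

lemma card_powersetCard_add_three_le (X : Finset ℝ) (Q : ℕ) (hQ : ∀ n, tripleRep X n ≤ Q) (k : ℕ) :
    ∀ n, #{T ∈ X.powersetCard (3 + k) | ∑ x ∈ T, x = n} ≤ #X ^ k * Q := by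
  induction k with
  | zero => intro n; simpa using (card_powersetCard_three_le X n).trans (hQ n)
  | succ k ih =>
    intro n
    refine (card_powersetCard_succ_le X (3 + k) _ ih n).trans (le_of_eq (by ring))

/-! ### The alteration method -/

lemma sum_powerset_superset (A e : Finset ℝ) (he : e ⊆ A) (p : ℝ) :
    ∑ B ∈ A.powerset with e ⊆ B, p ^ #B * (1 - p) ^ (#A - #B) = p ^ #e := by
  classical
  have h1 : ∑ B ∈ A.powerset with e ⊆ B, p ^ #B * (1 - p) ^ (#A - #B) =
      ∑ B ∈ (A \ e).powerset, p ^ #e * (p ^ #B * (1 - p) ^ (#(A \ e) - #B)) := by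
    symm
    refine sum_bij (fun B _ => e ∪ B) ?_ ?_ ?_ ?_
    · intro B hB
      rw [mem_powerset] at hB
      simp only [mem_filter, mem_powerset, subset_union_left, and_true]
      exact union_subset he (hB.trans sdiff_subset)
    · intro B hB B' hB' h
      rw [mem_powerset] at hB hB'
      have d1 : Disjoint B e := disjoint_of_subset_left hB sdiff_disjoint
      have d2 : Disjoint B' e := disjoint_of_subset_left hB' sdiff_disjoint
      rw [← union_sdiff_cancel_left d1.symm, h, union_sdiff_cancel_left d2.symm]
    · intro B hB
      simp only [mem_filter, mem_powerset] at hB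
      exact ⟨B \ e, mem_powerset.2 (sdiff_subset_sdiff hB.1 (Subset.refl _)),
        union_sdiff_of_subset hB.2⟩
    · intro B hB
      rw [mem_powerset] at hB
      have d1 : Disjoint e B := (disjoint_of_subset_left hB sdiff_disjoint).symm
      have c1 := card_le_card hB
      have c2 := card_sdiff_of_subset he
      have c3 := card_le_card he
      rw [card_union_of_disjoint d1, pow_add, c2, mul_assoc]
      congr 3
      omega
  rw [h1, ← mul_sum, sum_pow_mul_eq_add_pow]
  simp

/-- The **alteration method**: `A` contains a set of size at least `p |A| - ∑ p ^ |e|`, the sum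
running over a family of nonempty sets `e`, that contains no member of the family. -/
theorem exists_subset_no_edge (A : Finset ℝ) (F : Finset (Finset ℝ))
    (hF : ∀ e ∈ F, e ⊆ A ∧ e.Nonempty) (p : ℝ) (hp0 : 0 ≤ p) (hp1 : p ≤ 1) :
    ∃ B ⊆ A, (∀ e ∈ F, ¬ e ⊆ B) ∧ p * #A - ∑ e ∈ F, p ^ #e ≤ #B := by
  classical
  set w : Finset ℝ → ℝ := fun B => p ^ #B * (1 - p) ^ (#A - #B) with hw
  have hw0 : ∀ B, 0 ≤ w B := fun B => mul_nonneg (pow_nonneg hp0 _) (pow_nonneg (by linarith) _)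
  have hw1 : ∑ B ∈ A.powerset, w B = 1 := by
    rw [hw, sum_pow_mul_eq_add_pow]; simp
  have hcard : ∑ B ∈ A.powerset, w B * #B = p * #A := by
    have : ∀ B ∈ A.powerset, w B * #B = ∑ x ∈ A, if {x} ⊆ B then w B else 0 := by
      intro B hB
      rw [mem_powerset] at hB
      rw [← sum_filter, sum_const, nsmul_eq_mul, mul_comm]
      congr 3
      ext x; simp only [singleton_subset_iff, mem_filter]
      exact ⟨fun h => ⟨hB h, h⟩, fun h => h.2⟩
    rw [sum_congr rfl this, sum_comm]
    calc _ = ∑ x ∈ A, p := by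
          refine sum_congr rfl fun x hx => ?_
          rw [← sum_filter, sum_powerset_superset A {x} (by simpa using hx)]; simp
      _ = _ := by simp [mul_comm]
  have hedge : ∑ B ∈ A.powerset, w B * #{e ∈ F | e ⊆ B} = ∑ e ∈ F, p ^ #e := by
    have : ∀ B ∈ A.powerset, w B * #{e ∈ F | e ⊆ B} = ∑ e ∈ F, if e ⊆ B then w B else 0 := by
      intro B _
      rw [← sum_filter, sum_const, nsmul_eq_mul, mul_comm]
    rw [sum_congr rfl this, sum_comm]
    refine sum_congr rfl fun e he => ?_
    rw [← sum_filter, sum_powerset_superset A e (hF e he).1]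
  obtain ⟨B, hB, hle⟩ : ∃ B ∈ A.powerset,
      p * #A - ∑ e ∈ F, p ^ #e ≤ (#B : ℝ) - #{e ∈ F | e ⊆ B} := by
    by_contra! hcon
    have h1 : ∑ B ∈ A.powerset, w B * ((#B : ℝ) - #{e ∈ F | e ⊆ B}) <
        ∑ B ∈ A.powerset, w B * (p * #A - ∑ e ∈ F, p ^ #e) := by
      refine sum_lt_sum (fun B hB => mul_le_mul_of_nonneg_left (hcon B hB).le (hw0 B)) ?_
      obtain ⟨B, hB, hpos⟩ : ∃ B ∈ A.powerset, 0 < w B := by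
        by_contra! h
        have := sum_nonpos h
        linarith
      exact ⟨B, hB, mul_lt_mul_of_pos_left (hcon B hB) hpos⟩
    rw [← sum_mul, hw1] at h1
    simp_rw [mul_sub] at h1
    rw [sum_sub_distrib, hcard, hedge] at h1
    linarith
  rw [mem_powerset] at hB
  -- remove one point of each edge
  have hch : ∀ e : Finset ℝ, ∃ x, e ∈ F → x ∈ e := fun e => by
    by_cases he : e ∈ F
    · obtain ⟨x, hx⟩ := (hF e he).2
      exact ⟨x, fun _ => hx⟩
    · exact ⟨0, fun h => absurd h he⟩
  choose f hf using hch
  refine ⟨B \ ({e ∈ F | e ⊆ B}.image f), sdiff_subset.trans hB, ?_, ?_⟩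
  · intro e he hsub
    have h1 := hsub (hf e he)
    rw [mem_sdiff] at h1
    exact h1.2 (mem_image_of_mem f (mem_filter.2 ⟨he, hsub.trans sdiff_subset⟩))
  · refine hle.trans ?_
    have h1 := card_le_card_sdiff_add_card (s := B) (t := {e ∈ F | e ⊆ B}.image f)
    have h2 : #({e ∈ F | e ⊆ B}.image f) ≤ #{e ∈ F | e ⊆ B} := card_image_le
    have h3 : (#B : ℝ) ≤ #(B \ {e ∈ F | e ⊆ B}.image f) + #{e ∈ F | e ⊆ B} := by
      exact_mod_cast (by omega : #B ≤ #(B \ {e ∈ F | e ⊆ B}.image f) + #{e ∈ F | e ⊆ B})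
    linarith

/-! ### Sets satisfying many linear relations -/

/-- A coset of a subspace `V` of `ℝ^ι` meets the grid `Φ^ι` in at most `|Φ| ^ dim V` points. -/
lemma card_grid_coset_le {ι : Type*} [Fintype ι] [DecidableEq ι] (Φ : Finset ℝ) (d : ℕ) :
    ∀ (V : Submodule ℝ (ι → ℝ)), Module.finrank ℝ V = d → ∀ (S : Finset (ι → ℝ)),
      (∀ x ∈ S, ∀ i, x i ∈ Φ) → (∀ x ∈ S, ∀ y ∈ S, x - y ∈ V) → #S ≤ #Φ ^ d := by
  classical
  induction d with
  | zero =>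
    intro V hV S _ hSV
    rw [pow_zero, card_le_one]
    intro x hx y hy
    have h := hSV x hx y hy
    rw [Submodule.finrank_eq_zero.1 hV] at h
    exact sub_eq_zero.1 ((Submodule.mem_bot ℝ).1 h)
  | succ d ih =>
    intro V hV S hSΦ hSV
    have hne : V ≠ ⊥ := by
      rintro rfl; simp at hV
    obtain ⟨v, hvV, hv0⟩ := V.exists_mem_ne_zero_of_ne_bot hne
    obtain ⟨i, hi⟩ : ∃ i, v i ≠ 0 := by
      by_contra! h; exact hv0 (funext h)
    -- the slices of `S` by the `i`-th coordinate lie in cosets of a smaller subspace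
    set f : (ι → ℝ) →ₗ[ℝ] ℝ := LinearMap.proj i with hf
    set g : V →ₗ[ℝ] ℝ := f.comp V.subtype with hg
    have hsurj : Function.Surjective g := by
      intro a
      refine ⟨(a / v i) • ⟨v, hvV⟩, ?_⟩
      simp [hg, hf, hi]
    have hker : Module.finrank ℝ (LinearMap.ker g) = d := by
      have h1 := LinearMap.finrank_range_add_finrank_ker g
      rw [LinearMap.range_eq_top.2 hsurj, finrank_top, Module.finrank_self, hV] at h1
      omega
    have hker' : Module.finrank ℝ ((LinearMap.ker g).map V.subtype) = d := by
      rw [Submodule.finrank_map_subtype_eq, hker]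
    rw [pow_succ']
    rw [card_eq_sum_card_fiberwise (f := fun x => x i) (t := Φ) (fun x hx => hSΦ x hx i),
      ← smul_eq_mul]
    refine sum_le_card_nsmul _ _ _ fun a _ => ?_
    refine ih _ hker' _ (fun x hx => hSΦ x (mem_filter.1 hx).1) ?_
    intro x hx y hy
    rw [mem_filter] at hx hy
    refine ⟨⟨x - y, hSV x hx.1 y hy.1⟩, ?_, rfl⟩
    simp [hg, hf, hx.2, hy.2]

/-- The finite set `S` of reals satisfies `ρ` linearly independent linear relations with integer
coefficients in `[-h, h]`. -/
def HasRelations (h ρ : ℕ) (S : Finset ℝ) : Prop :=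
  ∃ w : Fin ρ → ℝ → ℤ, (∀ i x, w i x ∈ Icc (-(h : ℤ)) h) ∧ (∀ i, ∑ x ∈ S, (w i x : ℝ) * x = 0) ∧
    ∀ c : Fin ρ → ℝ, (∀ x ∈ S, ∑ i, c i * w i x = 0) → c = 0

lemma card_grid_ker_mul_le {ρ k : ℕ} (Φ : Finset ℝ) (W : Matrix (Fin ρ) (Fin k) ℝ)
    (hW : LinearIndependent ℝ W.row) (S : Finset (Fin k → ℝ)) (hΦ : ∀ x ∈ S, ∀ i, x i ∈ Φ)
    (hS : ∀ x ∈ S, W.mulVec x = 0) : #S * #Φ ^ ρ ≤ #Φ ^ k := by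
  have h1 := LinearMap.finrank_range_add_finrank_ker W.mulVecLin
  have h2 : Module.finrank ℝ (LinearMap.range W.mulVecLin) = ρ := by
    have := hW.rank_matrix
    rwa [Matrix.rank, Fintype.card_fin] at this
  rw [h2, Module.finrank_fin_fun] at h1
  have h3 := card_grid_coset_le Φ _ (LinearMap.ker W.mulVecLin) rfl S hΦ (by
    intro x hx y hy
    rw [LinearMap.mem_ker, map_sub, Matrix.mulVecLin_apply, Matrix.mulVecLin_apply, hS x hx,
      hS y hy, sub_zero])
  calc _ ≤ #Φ ^ (Module.finrank ℝ (LinearMap.ker W.mulVecLin)) * #Φ ^ ρ :=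
        Nat.mul_le_mul_right _ h3
    _ = #Φ ^ k := by rw [← pow_add, add_comm, h1]

open Classical in
/-- Each relation costs a factor `|Φ|` in the number of `k`-subsets of `Φ`. -/
lemma card_hasRelations_mul_le (Φ : Finset ℝ) (h ρ k : ℕ) :
    #{S ∈ Φ.powersetCard k | HasRelations h ρ S} * #Φ ^ ρ ≤
      (2 * h + 1) ^ (k * ρ) * #Φ ^ k := by
  set 𝒲 : Finset (Fin ρ → Fin k → ℤ) :=
    Fintype.piFinset fun _ => Fintype.piFinset fun _ => Icc (-(h : ℤ)) h with h𝒲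
  set toM : (Fin ρ → Fin k → ℤ) → Matrix (Fin ρ) (Fin k) ℝ :=
    fun W => Matrix.of fun i j => (W i j : ℝ) with htoM
  set X : (Fin ρ → Fin k → ℤ) → Finset (Fin k → ℝ) := fun W =>
    {x ∈ Fintype.piFinset fun _ => Φ | (toM W).mulVec x = 0} with hX
  set 𝒲' := {W ∈ 𝒲 | LinearIndependent ℝ (toM W).row} with h𝒲'
  have h𝒲c : #𝒲 = (2 * h + 1) ^ (k * ρ) := by
    simp only [h𝒲, Fintype.card_piFinset, prod_const, Int.card_Icc, card_univ, Fintype.card_fin]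
    rw [← pow_mul]; congr 1; omega
  have h1 : #{S ∈ Φ.powersetCard k | HasRelations h ρ S} ≤ #(𝒲'.sigma X) := by
    refine card_le_card_of_surjOn (fun p => univ.image p.2) ?_
    intro S hS
    simp only [coe_filter, Set.mem_ofPred_eq, mem_powersetCard] at hS
    obtain ⟨⟨hSΦ, hSk⟩, w, hw1, hw2, hw3⟩ := hS
    set e := S.orderEmbOfFin hSk with he
    have himg : univ.image e = S := S.image_orderEmbOfFin_univ hSk
    refine ⟨⟨fun i j => w i (e j), e⟩, ?_, himg⟩
    simp only [coe_sigma, Set.mem_sigma_iff, mem_coe, h𝒲', hX, mem_filter, h𝒲,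
      Fintype.mem_piFinset]
    refine ⟨⟨fun i j => hw1 _ _, ?_⟩, fun j => hSΦ (S.orderEmbOfFin_mem hSk j), ?_⟩
    · rw [Fintype.linearIndependent_iff]
      intro c hc
      refine fun i => congrFun (hw3 c fun x hx => ?_) i
      rw [← himg] at hx
      obtain ⟨j, -, rfl⟩ := mem_image.1 hx
      have := congrFun hc j
      simpa [htoM, Matrix.row] using this
    · funext i
      have := hw2 i
      rw [← himg, sum_image (fun a _ b _ hab => e.injective hab)] at this
      simpa [Matrix.mulVec, dotProduct, htoM] using this
  calc _ ≤ #(𝒲'.sigma X) * #Φ ^ ρ := Nat.mul_le_mul_right _ h1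
    _ = ∑ W ∈ 𝒲', #(X W) * #Φ ^ ρ := by rw [card_sigma, sum_mul]
    _ ≤ ∑ W ∈ 𝒲', #Φ ^ k := by
        refine sum_le_sum fun W hW => ?_
        refine card_grid_ker_mul_le Φ (toM W) (mem_filter.1 hW).2 _ ?_ ?_
        · intro x hx i
          exact Fintype.mem_piFinset.1 (mem_filter.1 hx).1 i
        · intro x hx
          exact (mem_filter.1 hx).2
    _ = #𝒲' * #Φ ^ k := by simp
    _ ≤ _ := by
        rw [← h𝒲c]
        exact Nat.mul_le_mul_right _ (card_filter_le _ _)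

/-! ### Families of multisets of equal sum -/

/-- Linear independence over `ℝ` of the multiplicity vectors of the multisets in `F`. -/
def IndepMultisets (F : Finset (Multiset ℝ)) : Prop :=
  ∀ c : Multiset ℝ → ℝ, (∀ x, ∑ N ∈ F, c N * (N.count x : ℝ) = 0) → ∀ N ∈ F, c N = 0

/-- The set of all elements of the members of `F`. -/
noncomputable def unionSupport (F : Finset (Multiset ℝ)) : Finset ℝ := F.biUnion Multiset.toFinset

/-- The total multiplicity of `x` in the members of `F`. -/
noncomputable def totalCount (F : Finset (Multiset ℝ)) (x : ℝ) : ℕ := ∑ N ∈ F, N.count x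

lemma mem_unionSupport {F : Finset (Multiset ℝ)} {N : Multiset ℝ} (hN : N ∈ F) {x : ℝ}
    (hx : x ∈ N) : x ∈ unionSupport F :=
  mem_biUnion.2 ⟨N, hN, Multiset.mem_toFinset.2 hx⟩

lemma count_le_totalCount {F : Finset (Multiset ℝ)} {N : Multiset ℝ} (hN : N ∈ F) (x : ℝ) :
    N.count x ≤ totalCount F x :=
  single_le_sum (f := fun N : Multiset ℝ => N.count x) (fun _ _ => Nat.zero_le _) hN

lemma one_le_totalCount {F : Finset (Multiset ℝ)} {x : ℝ} (hx : x ∈ unionSupport F) :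
    1 ≤ totalCount F x := by
  obtain ⟨N, hN, hxN⟩ := mem_biUnion.1 hx
  exact (Multiset.one_le_count_iff_mem.2 (Multiset.mem_toFinset.1 hxN)).trans
    (count_le_totalCount hN x)

lemma sum_count_unionSupport {F : Finset (Multiset ℝ)} {N : Multiset ℝ} (hN : N ∈ F) :
    ∑ x ∈ unionSupport F, N.count x = N.card :=
  Multiset.sum_count_eq_card fun _ hx => mem_unionSupport hN hx

lemma sum_totalCount {F : Finset (Multiset ℝ)} {h : ℕ} (hF : ∀ N ∈ F, N.card = h) :
    ∑ x ∈ unionSupport F, totalCount F x = #F * h := by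
  simp only [totalCount]
  rw [sum_comm, ← smul_eq_mul, ← sum_const]
  exact sum_congr rfl fun N hN => by rw [sum_count_unionSupport hN, hF N hN]

/-- The overlap `∑ (totalCount - 1)` of a family with large support is small. -/
lemma sum_totalCount_sub_one_lt {F : Finset (Multiset ℝ)} {h : ℕ} (hF : ∀ N ∈ F, N.card = h)
    (hov : #F * h < #(unionSupport F) + h) :
    ∑ x ∈ unionSupport F, (totalCount F x - 1) < h := by
  have h1 : ∑ x ∈ unionSupport F, (totalCount F x - 1) + #(unionSupport F) = #F * h := by
    rw [← sum_totalCount hF, card_eq_sum_ones, ← sum_add_distrib]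
    refine sum_congr rfl fun x hx => ?_
    have := one_le_totalCount hx
    omega
  omega

lemma count_eq_mul_of_private {F : Finset (Multiset ℝ)} {M N : Multiset ℝ} {c : Multiset ℝ → ℝ}
    (hN : N ∈ F) {x : ℝ} (hx : totalCount F x = N.count x)
    (hM : (M.count x : ℝ) = ∑ N ∈ F, c N * (N.count x : ℝ)) :
    (M.count x : ℝ) = c N * N.count x := by
  rw [hM]
  refine sum_eq_single_of_mem N hN fun N' hN' hne => ?_
  have h1 : ∑ N' ∈ F.erase N, N'.count x = 0 := by
    have := add_sum_erase F (fun N : Multiset ℝ => N.count x) hN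
    rw [totalCount] at hx
    omega
  have h2 := (sum_eq_zero_iff.1 h1) N' (mem_erase.2 ⟨hne, hN'⟩)
  rw [h2]; simp

/-- A family of `h`-multisets whose total overlap is less than `h` contains every `h`-multiset in
its linear span. Each member has an element of its own, so the coefficients are nonnegative; if
two of them lay strictly between `0` and `1`, the elements of the two members would all be
repeated or shared, which makes the overlap at least `h`. -/
lemma mem_of_count_eq_sum {F : Finset (Multiset ℝ)} {h : ℕ} (hh : 0 < h)
    (hF : ∀ N ∈ F, N.card = h) (hov : #F * h < #(unionSupport F) + h) {M : Multiset ℝ}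
    (hMc : M.card = h) {c : Multiset ℝ → ℝ}
    (hM : ∀ x, (M.count x : ℝ) = ∑ N ∈ F, c N * (N.count x : ℝ)) : M ∈ F := by
  have hsum := sum_totalCount_sub_one_lt hF hov
  have hh' : (0 : ℝ) < h := by exact_mod_cast hh
  have hc0 : ∀ N ∈ F, 0 ≤ c N := by
    intro N hN
    obtain ⟨x, hxN, hx⟩ : ∃ x ∈ N, totalCount F x = N.count x := by
      by_contra! hcon
      have : ∑ x ∈ unionSupport F, N.count x ≤ ∑ x ∈ unionSupport F, (totalCount F x - 1) := by
        refine sum_le_sum fun x _ => ?_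
        by_cases hxN : x ∈ N
        · have h1 := hcon x hxN
          have h2 := count_le_totalCount hN x
          omega
        · rw [Multiset.count_eq_zero_of_notMem hxN]; exact Nat.zero_le _
      rw [sum_count_unionSupport hN, hF N hN] at this
      omega
    have h1 := count_eq_mul_of_private hN hx (hM x)
    have h2 : (0 : ℝ) < N.count x := by exact_mod_cast Multiset.count_pos.2 hxN
    have h3 : (0 : ℝ) ≤ c N * N.count x := by rw [← h1]; positivity
    exact nonneg_of_mul_nonneg_left h3 h2
  have hMU : ∀ x ∈ M, x ∈ unionSupport F := by
    intro x hx
    by_contra hxU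
    have h1 : (M.count x : ℝ) = 0 := by
      rw [hM x]
      refine sum_eq_zero fun N hN => ?_
      rw [Multiset.count_eq_zero_of_notMem fun hxN => hxU (mem_unionSupport hN hxN)]; simp
    have h2 := Multiset.count_pos.2 hx
    have h3 : M.count x = 0 := by exact_mod_cast h1
    omega
  have hc1 : ∑ N ∈ F, c N = 1 := by
    have h1 : (h : ℝ) = (∑ N ∈ F, c N) * h := by
      calc (h : ℝ) = ∑ x ∈ unionSupport F, (M.count x : ℝ) := by
            rw [← hMc, ← Multiset.sum_count_eq_card hMU]; push_cast; rfl
        _ = ∑ x ∈ unionSupport F, ∑ N ∈ F, c N * (N.count x : ℝ) := sum_congr rfl fun x _ => hM x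
        _ = ∑ N ∈ F, c N * h := by
            rw [sum_comm]
            refine sum_congr rfl fun N hN => ?_
            rw [← mul_sum, ← hF N hN, ← sum_count_unionSupport hN]; push_cast; rfl
        _ = _ := by rw [sum_mul]
    field_simp at h1
    linarith
  by_contra hMF
  have hlt : ∀ N ∈ F, c N < 1 := by
    intro N hN
    have h1 := add_sum_erase F c hN
    have h2 : 0 ≤ ∑ N ∈ F.erase N, c N := sum_nonneg fun N' hN' => hc0 N' (mem_of_mem_erase hN')
    refine lt_of_le_of_ne (by linarith) fun h3 => hMF ?_
    have h4 : ∑ N ∈ F.erase N, c N = 0 := by linarith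
    have h5 := (sum_eq_zero_iff_of_nonneg fun N' hN' => hc0 N' (mem_of_mem_erase hN')).1 h4
    have : M = N := by
      ext x
      have h6 := hM x
      rw [sum_eq_single_of_mem N hN fun N' hN' hne => by
        rw [h5 N' (mem_erase.2 ⟨hne, hN'⟩), zero_mul], h3, one_mul] at h6
      exact_mod_cast h6
    rwa [this]
  obtain ⟨i, hi, hci⟩ : ∃ i ∈ F, 0 < c i := by
    by_contra! hcon
    have := sum_nonpos hcon
    linarith
  obtain ⟨j, hj, hcj⟩ : ∃ j ∈ F.erase i, 0 < c j := by
    by_contra! hcon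
    have h1 := sum_nonpos hcon
    have h2 := add_sum_erase F c hi
    have h3 := hlt i hi
    linarith
  have hjF := mem_of_mem_erase hj
  -- an element of total multiplicity one cannot belong to a member of fractional coefficient
  have hfrac : ∀ k ∈ F, 0 < c k → ∀ x, k.count x = 1 → totalCount F x ≠ 1 := by
    intro k hk hck x hkx htx
    have h1 := count_eq_mul_of_private hk (htx.trans hkx.symm) (hM x)
    rw [hkx, Nat.cast_one, mul_one] at h1
    have h2 := hlt k hk
    rw [← h1] at hck h2
    have h3 : 0 < M.count x := by exact_mod_cast hck
    have h4 : M.count x < 1 := by exact_mod_cast h2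
    omega
  have hpt : ∀ x ∈ unionSupport F, i.count x + j.count x ≤ 2 * (totalCount F x - 1) := by
    intro x hx
    have h1 : i.count x + j.count x ≤ totalCount F x := by
      rw [totalCount, ← add_sum_erase F _ hi]
      exact Nat.add_le_add_left
        (single_le_sum (f := fun N : Multiset ℝ => N.count x) (fun _ _ => Nat.zero_le _) hj) _
    have h2 := hfrac i hi hci x
    have h3 := hfrac j hjF hcj x
    have h4 := one_le_totalCount hx
    omega
  have h1 := sum_le_sum hpt
  rw [sum_add_distrib, sum_count_unionSupport hi, sum_count_unionSupport hjF, hF i hi, hF j hjF,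
    ← mul_sum] at h1
  omega

/-- Independent families of `h`-multisets of equal sum have large support if no small set
satisfies many relations. -/
lemma card_mul_lt_card_unionSupport {F : Finset (Multiset ℝ)} {h g : ℕ} (hh : 0 < h) {n : ℝ}
    {B : Finset ℝ} (hF : ∀ N ∈ F, N.card = h ∧ (∀ x ∈ N, x ∈ B) ∧ N.sum = n)
    (hB : ∀ ρ, 1 ≤ ρ → ρ ≤ g → ∀ S ⊆ B, #S ≤ ρ * h → ¬ HasRelations h ρ S)
    (hFg : #F ≤ g + 1) (hind : IndepMultisets F) : #F * h < #(unionSupport F) + h := by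
  rcases F.eq_empty_or_nonempty with rfl | ⟨N₀, hN₀⟩
  · simp [hh]
  obtain ⟨ρ, hρ⟩ : ∃ ρ, #F = ρ + 1 := ⟨#F - 1, by have := card_pos.2 ⟨N₀, hN₀⟩; omega⟩
  by_contra! hcon
  have hUc : #(unionSupport F) ≤ ρ * h := by rw [hρ] at hcon; nlinarith
  have hUB : unionSupport F ⊆ B := biUnion_subset.2 fun N hN x hx =>
    (hF N hN).2.1 x (Multiset.mem_toFinset.1 hx)
  have hρ1 : 1 ≤ ρ := by
    by_contra h0
    have h1 : ρ = 0 := by omega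
    rw [h1, zero_mul] at hUc
    have h2 : 0 < N₀.card := by rw [(hF N₀ hN₀).1]; exact hh
    obtain ⟨x, hx⟩ := Multiset.card_pos_iff_exists_mem.1 h2
    have h3 := card_pos.2 ⟨x, mem_unionSupport hN₀ hx⟩
    omega
  refine hB ρ hρ1 (by omega) _ hUB hUc ?_
  have hec : #(F.erase N₀) = ρ := by rw [card_erase_of_mem hN₀]; omega
  set e := ((F.erase N₀).equivFinOfCardEq hec).symm with he
  have heF : ∀ i, (e i : Multiset ℝ) ∈ F := fun i => mem_of_mem_erase (e i).2
  refine ⟨fun i x => (e i : Multiset ℝ).count x - N₀.count x, ?_, ?_, ?_⟩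
  · intro i x
    have h1 := Multiset.count_le_card x (e i : Multiset ℝ)
    have h2 := Multiset.count_le_card x N₀
    rw [(hF _ (heF i)).1] at h1
    rw [(hF _ hN₀).1] at h2
    simp only [mem_Icc]; omega
  · intro i
    have h1 : ∀ N ∈ F, ∑ x ∈ unionSupport F, (N.count x : ℝ) * x = n := by
      intro N hN
      rw [← (hF N hN).2.2, sum_multiset_count_of_subset N (unionSupport F)
        fun x hx => mem_unionSupport hN (Multiset.mem_toFinset.1 hx)]
      simp
    push_cast
    simp_rw [sub_mul]
    rw [sum_sub_distrib, h1 _ (heF i), h1 _ hN₀, sub_self]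
  · intro c hc
    set C : Multiset ℝ → ℝ := fun N =>
      if hN : N ∈ F.erase N₀ then c (e.symm ⟨N, hN⟩) else - ∑ i, c i with hC
    have hCe : ∀ i, C (e i) = c i := by
      intro i
      simp only [hC, (e i).2, dif_pos, Subtype.coe_eta, Equiv.symm_apply_apply]
    have hC0 : C N₀ = - ∑ i, c i := by simp [hC]
    have key : ∀ x, ∑ N ∈ F, C N * (N.count x : ℝ) = 0 := by
      intro x
      by_cases hx : x ∈ unionSupport F
      · have h1 := hc x hx
        rw [← add_sum_erase F _ hN₀, hC0, ← sum_coe_sort (F.erase N₀),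
          ← e.sum_comp (fun N => C N * ((N : Multiset ℝ).count x : ℝ))]
        simp_rw [hCe]
        push_cast at h1
        simp_rw [mul_sub] at h1
        rw [sum_sub_distrib, ← sum_mul] at h1
        linarith
      · refine sum_eq_zero fun N hN => ?_
        rw [Multiset.count_eq_zero_of_notMem fun hxN => hx (mem_unionSupport hN hxN)]; simp
    have h2 := hind C key
    funext i
    rw [← hCe i]
    exact h2 _ (heF i)

/-- By induction on the family: an independent family has overlap less than `h`, so that a further
multiset cannot lie in its span. -/
lemma indepMultisets_of_forall_not_hasRelations {h g : ℕ} (hh : 0 < h) {n : ℝ}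
    {B : Finset ℝ} (hB : ∀ ρ, 1 ≤ ρ → ρ ≤ g → ∀ S ⊆ B, #S ≤ ρ * h → ¬ HasRelations h ρ S)
    (F : Finset (Multiset ℝ)) (hF : ∀ N ∈ F, N.card = h ∧ (∀ x ∈ N, x ∈ B) ∧ N.sum = n)
    (hFg : #F ≤ g + 1) : IndepMultisets F := by
  classical
  induction F using Finset.induction_on with
  | empty => intro c _ N hN; simp at hN
  | insert M F hM ih =>
    rw [card_insert_of_notMem hM] at hFg
    have hF' : ∀ N ∈ F, N.card = h ∧ (∀ x ∈ N, x ∈ B) ∧ N.sum = n :=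
      fun N hN => hF N (mem_insert_of_mem hN)
    have hind := ih hF' (by omega)
    have hov := card_mul_lt_card_unionSupport hh hF' hB (by omega) hind
    intro c hc
    simp_rw [sum_insert hM] at hc
    have hcM : c M = 0 := by
      by_contra hne
      refine hM (mem_of_count_eq_sum hh (fun N hN => (hF' N hN).1) hov
        (hF M (mem_insert_self _ _)).1 (c := fun N => - c N / c M) fun x => ?_)
      have h1 := hc x
      have h2 : ∑ N ∈ F, - c N / c M * (N.count x : ℝ) =
          - (∑ N ∈ F, c N * (N.count x : ℝ)) / c M := by
        rw [← sum_neg_distrib, sum_div]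
        exact sum_congr rfl fun N _ => by ring
      rw [h2]
      field_simp
      linarith
    rw [hcM] at hc
    simp only [zero_mul, zero_add] at hc
    intro N hN
    rcases mem_insert.1 hN with rfl | hN
    · exact hcM
    · exact hind c hc N hN

/-- If no small subset of `B` satisfies many relations and `B` has no `m` disjoint `h`-subsets of
equal sum, then no number has more than `g` representations: `g + 1` of them would be independent,
hence of overlap less than `h`, so all but `2 (h - 1)` of them would be disjoint sets. -/
theorem card_sym_filter_le {h g m : ℕ} (hh : 0 < h) (hgm : m + 2 * h ≤ g + 3) {B : Finset ℝ}
    (hB : ∀ ρ, 1 ≤ ρ → ρ ≤ g → ∀ S ⊆ B, #S ≤ ρ * h → ¬ HasRelations h ρ S)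
    (hD : ∀ (T : Fin m → Finset ℝ) (n : ℝ), (∀ i, T i ⊆ B ∧ #(T i) = h ∧ ∑ x ∈ T i, x = n) →
      ¬ Pairwise fun i j => Disjoint (T i) (T j)) (n : ℝ) :
    #((B.sym h).filter fun s : Sym ℝ h => (s : Multiset ℝ).sum = n) ≤ g := by
  classical
  by_contra! hcon
  obtain ⟨F₀, hF₀, hF₀c⟩ := exists_subset_card_eq (Nat.succ_le_of_lt hcon)
  set F : Finset (Multiset ℝ) := F₀.image (fun s : Sym ℝ h => (s : Multiset ℝ)) with hFdef
  have hFc : #F = g + 1 := by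
    rw [hFdef, card_image_of_injective _ Sym.coe_injective, hF₀c]
  have hF : ∀ N ∈ F, N.card = h ∧ (∀ x ∈ N, x ∈ B) ∧ N.sum = n := by
    intro N hN
    obtain ⟨s, hs, rfl⟩ := mem_image.1 hN
    have h1 := mem_filter.1 (hF₀ hs)
    exact ⟨s.2, fun x hx => mem_sym_iff.1 h1.1 x hx, h1.2⟩
  have hind := indepMultisets_of_forall_not_hasRelations hh hB F hF hFc.le
  have hov := card_mul_lt_card_unionSupport hh hF hB hFc.le hind
  have hsum := sum_totalCount_sub_one_lt (fun N hN => (hF N hN).1) hov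
  -- the members all of whose elements have total multiplicity one
  set F' := {N ∈ F | ∀ x ∈ N, totalCount F x = 1} with hF'
  have hdirty : #(F \ F') ≤ 2 * (h - 1) := by
    calc #(F \ F') = ∑ N ∈ F \ F', 1 := by simp
      _ ≤ ∑ N ∈ F \ F', ∑ x ∈ unionSupport F with totalCount F x ≠ 1, N.count x := by
          refine sum_le_sum fun N hN => ?_
          simp only [hF', mem_sdiff, mem_filter, not_and, not_forall] at hN
          obtain ⟨hNF, hN⟩ := hN
          obtain ⟨x, hxN, hx⟩ := hN hNF
          refine (Multiset.one_le_count_iff_mem.2 hxN).trans ?_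
          exact single_le_sum (f := fun x => N.count x) (fun _ _ => Nat.zero_le _)
            (mem_filter.2 ⟨mem_unionSupport hNF hxN, hx⟩)
      _ ≤ ∑ N ∈ F, ∑ x ∈ unionSupport F with totalCount F x ≠ 1, N.count x :=
          sum_le_sum_of_subset sdiff_subset
      _ = ∑ x ∈ unionSupport F with totalCount F x ≠ 1, totalCount F x := sum_comm
      _ ≤ ∑ x ∈ unionSupport F with totalCount F x ≠ 1, 2 * (totalCount F x - 1) := by
          refine sum_le_sum fun x hx => ?_
          rw [mem_filter] at hx
          have h1 := one_le_totalCount hx.1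
          have h2 := hx.2
          omega
      _ ≤ ∑ x ∈ unionSupport F, 2 * (totalCount F x - 1) :=
          sum_le_sum_of_subset (filter_subset _ _)
      _ = 2 * ∑ x ∈ unionSupport F, (totalCount F x - 1) := by rw [mul_sum]
      _ ≤ _ := by omega
  have hF'c : m ≤ #F' := by
    have h1 : #(F \ F') + #F' = #F := card_sdiff_add_card_eq_card (filter_subset _ _)
    omega
  obtain ⟨F'', hF'', hF''c⟩ := exists_subset_card_eq hF'c
  set e := (F''.equivFinOfCardEq hF''c).symm with he
  have heF' : ∀ i, (e i : Multiset ℝ) ∈ F' := fun i => hF'' (e i).2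
  have heF : ∀ i, (e i : Multiset ℝ) ∈ F := fun i => (mem_filter.1 (heF' i)).1
  have hone : ∀ i, ∀ x ∈ (e i : Multiset ℝ), totalCount F x = 1 := fun i =>
    (mem_filter.1 (heF' i)).2
  have hnodup : ∀ i, (e i : Multiset ℝ).Nodup := by
    intro i
    rw [Multiset.nodup_iff_count_le_one]
    intro x
    by_cases hx : x ∈ (e i : Multiset ℝ)
    · rw [← hone i x hx]; exact count_le_totalCount (heF i) x
    · rw [Multiset.count_eq_zero_of_notMem hx]; exact zero_le_one
  refine hD (fun i => (e i : Multiset ℝ).toFinset) n (fun i => ⟨?_, ?_, ?_⟩) ?_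
  · intro x hx
    exact (hF _ (heF i)).2.1 x (Multiset.mem_toFinset.1 hx)
  · rw [Multiset.toFinset_card_of_nodup (hnodup i), (hF _ (heF i)).1]
  · rw [← (hF _ (heF i)).2.2, sum_multiset_count]
    refine sum_congr rfl fun x hx => ?_
    rw [Multiset.count_eq_one_of_mem (hnodup i) (Multiset.mem_toFinset.1 hx), one_smul]
  · intro i j hij
    rw [disjoint_left]
    intro x hxi hxj
    rw [Multiset.mem_toFinset] at hxi hxj
    have hne : (e j : Multiset ℝ) ≠ e i := fun h => hij (e.injective (Subtype.ext h.symm))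
    have h1 := hone i x hxi
    rw [totalCount, ← add_sum_erase F _ (heF i)] at h1
    have h2 := single_le_sum (f := fun N : Multiset ℝ => N.count x) (fun _ _ => Nat.zero_le _)
      (mem_erase.2 ⟨hne, heF j⟩)
    have h3 := Multiset.count_pos.2 hxi
    have h4 := Multiset.count_pos.2 hxj
    omega

/-! ### Random subsets with few representations -/

lemma not_hasRelations_empty {h ρ : ℕ} (hρ : 1 ≤ ρ) : ¬ HasRelations h ρ ∅ := by
  rintro ⟨w, -, -, hw⟩
  have := congrFun (hw (fun _ => 1) (by simp)) ⟨0, hρ⟩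
  simp at this

lemma card_equal_sum_tuples_le (X : Finset ℝ) (h k Q : ℕ)
    (hQ : ∀ n, #{T ∈ X.powersetCard h | ∑ x ∈ T, x = n} ≤ Q) :
    #{T ∈ Fintype.piFinset fun _ : Fin (k + 1) => X.powersetCard h |
      ∀ i, ∑ x ∈ T i, x = ∑ x ∈ T 0, x} ≤ #X ^ h * Q ^ k := by
  classical
  have h1 : #{T ∈ Fintype.piFinset fun _ : Fin (k + 1) => X.powersetCard h |
      ∀ i, ∑ x ∈ T i, x = ∑ x ∈ T 0, x} ≤ #((X.powersetCard h).sigma fun T₀ =>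
        Fintype.piFinset fun _ : Fin k => {T ∈ X.powersetCard h | ∑ x ∈ T, x = ∑ x ∈ T₀, x}) := by
    refine card_le_card_of_injOn (fun T => ⟨T 0, fun i => T i.succ⟩) ?_ ?_
    · intro T hT
      simp only [coe_filter, Set.mem_ofPred_eq, Fintype.mem_piFinset] at hT
      simp only [coe_sigma, Set.mem_sigma_iff, mem_coe, Fintype.mem_piFinset, mem_filter]
      exact ⟨hT.1 0, fun i => ⟨hT.1 _, hT.2 _⟩⟩
    · intro T _ T' _ hTT
      simp only [Sigma.mk.injEq, heq_eq_eq] at hTT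
      funext i
      refine Fin.cases hTT.1 (fun i => congrFun hTT.2 i) i
  refine h1.trans ?_
  rw [card_sigma]
  calc _ ≤ ∑ T₀ ∈ X.powersetCard h, Q ^ k := by
        refine sum_le_sum fun T₀ _ => ?_
        rw [Fintype.card_piFinset_const]
        exact Nat.pow_le_pow_left (hQ _) _
    _ = (#X).choose h * Q ^ k := by simp
    _ ≤ _ := Nat.mul_le_mul_right _ (Nat.choose_le_pow _ _)

open Classical in
/-- The subsets of `Φ` that satisfy many relations for their size. -/
noncomputable def relationEdges (Φ : Finset ℝ) (h g : ℕ) : Finset (Finset ℝ) :=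
  (Icc 1 g).biUnion fun ρ => (Icc 1 (ρ * h)).biUnion fun k =>
    {S ∈ Φ.powersetCard k | HasRelations h ρ S}

open Classical in
/-- The unions of `k + 1` pairwise disjoint `h`-subsets of `Φ` of equal sum. -/
noncomputable def disjointEdges (Φ : Finset ℝ) (h k : ℕ) : Finset (Finset ℝ) :=
  {T ∈ {T ∈ Fintype.piFinset fun _ : Fin (k + 1) => Φ.powersetCard h |
      ∀ i, ∑ x ∈ T i, x = ∑ x ∈ T 0, x} | Pairwise fun i j => Disjoint (T i) (T j)}.image
    fun T => univ.biUnion T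

lemma mem_disjointEdges_props {Φ : Finset ℝ} {h k : ℕ} {e : Finset ℝ}
    (he : e ∈ disjointEdges Φ h k) : e ⊆ Φ ∧ #e = h * (k + 1) := by
  classical
  obtain ⟨T, hT, rfl⟩ := mem_image.1 he
  simp only [mem_filter, Fintype.mem_piFinset, mem_powersetCard] at hT
  refine ⟨biUnion_subset.2 fun i _ => (hT.1.1 i).1, ?_⟩
  rw [card_biUnion fun i _ j _ hij => hT.2 hij, sum_congr rfl fun i _ => (hT.1.1 i).2]
  simp [mul_comm]

lemma mem_relationEdges_props {Φ : Finset ℝ} {h g : ℕ} {e : Finset ℝ}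
    (he : e ∈ relationEdges Φ h g) : e ⊆ Φ ∧ e.Nonempty := by
  classical
  simp only [relationEdges, mem_biUnion, mem_Icc, mem_filter, mem_powersetCard] at he
  obtain ⟨ρ, -, k, hk, he, -⟩ := he
  exact ⟨he.1, card_pos.1 (by omega)⟩

lemma card_sym_filter_le_of_no_edge {h g k : ℕ} (hh : 0 < h) (hgk : k + 1 + 2 * h ≤ g + 3)
    {Φ B : Finset ℝ} (hBΦ : B ⊆ Φ) (hB : ∀ e ∈ relationEdges Φ h g ∪ disjointEdges Φ h k, ¬ e ⊆ B)
    (n : ℝ) : #((B.sym h).filter fun s : Sym ℝ h => (s : Multiset ℝ).sum = n) ≤ g := by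
  classical
  refine card_sym_filter_le hh hgk ?_ ?_ n
  · intro ρ hρ1 hρg S hS hSc hrel
    rcases S.eq_empty_or_nonempty with rfl | hne
    · exact not_hasRelations_empty hρ1 hrel
    refine hB S (mem_union_left _ ?_) hS
    simp only [relationEdges, mem_biUnion, mem_Icc, mem_filter, mem_powersetCard]
    exact ⟨ρ, ⟨hρ1, hρg⟩, #S, ⟨hne.card_pos, hSc⟩, ⟨hS.trans hBΦ, rfl⟩, hrel⟩
  · intro T n hT hdis
    refine hB (univ.biUnion T) (mem_union_right _ (mem_image_of_mem _ ?_))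
      (biUnion_subset.2 fun i _ => (hT i).1)
    simp only [mem_filter, Fintype.mem_piFinset, mem_powersetCard]
    exact ⟨⟨fun i => ⟨(hT i).1.trans hBΦ, (hT i).2.1⟩,
      fun i => (hT i).2.2.trans (hT 0).2.2.symm⟩, hdis⟩

lemma sum_biUnion_le_sum_of_nonneg {ι α : Type*} [DecidableEq α] (s : Finset ι)
    (t : ι → Finset α) (f : α → ℝ) (hf : ∀ a, 0 ≤ f a) :
    ∑ a ∈ s.biUnion t, f a ≤ ∑ i ∈ s, ∑ a ∈ t i, f a := by
  classical
  induction s using Finset.induction_on with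
  | empty => simp
  | insert i s hi ih =>
    rw [biUnion_insert, sum_insert hi]
    have h1 := sum_union_inter (s₁ := t i) (s₂ := s.biUnion t) (f := f)
    have h2 : 0 ≤ ∑ a ∈ t i ∩ s.biUnion t, f a := sum_nonneg fun a _ => hf a
    linarith

/-- The hypothesis `hY` says that `p |Φ| = |Φ| ^ (1 / h)` up to the small factor `Y`. Then `k ≤ ρ h`
elements subject to `ρ` relations have expected number `O(Y ^ ρ)`. -/
lemma sum_pow_card_relationEdges_le {Φ : Finset ℝ} {h g : ℕ} (hΦ : Φ.Nonempty) {p : ℝ}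
    (hp : 0 ≤ p) (hpN : 1 ≤ p * #Φ) {Y : ℝ} (hY1 : 1 ≤ Y) (hY : (p * #Φ) ^ h = #Φ * Y) :
    ∑ e ∈ relationEdges Φ h g, p ^ #e ≤
      (∑ ρ ∈ Icc 1 g, ∑ k ∈ Icc 1 (ρ * h), ((2 * h + 1 : ℕ) : ℝ) ^ (k * ρ)) * Y ^ g := by
  classical
  have hN : 0 < (#Φ : ℝ) := by exact_mod_cast hΦ.card_pos
  have hsum : ∑ e ∈ relationEdges Φ h g, p ^ #e ≤ ∑ ρ ∈ Icc 1 g, ∑ k ∈ Icc 1 (ρ * h),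
      ∑ e ∈ Φ.powersetCard k with HasRelations h ρ e, p ^ #e := by
    have h0 : ∀ e : Finset ℝ, 0 ≤ p ^ #e := fun e => pow_nonneg hp _
    exact (sum_biUnion_le_sum_of_nonneg _ _ _ h0).trans (sum_le_sum fun ρ _ =>
      sum_biUnion_le_sum_of_nonneg _ _ _ h0)
  refine hsum.trans ?_
  rw [sum_mul]
  refine sum_le_sum fun ρ hρ => ?_
  rw [sum_mul]
  refine sum_le_sum fun k hk => ?_
  rw [mem_Icc] at hρ hk
  have h1 : ∑ e ∈ Φ.powersetCard k with HasRelations h ρ e, p ^ #e =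
      #{e ∈ Φ.powersetCard k | HasRelations h ρ e} * p ^ k := by
    rw [← nsmul_eq_mul, ← sum_const]
    refine sum_congr rfl fun e he => ?_
    rw [(mem_powersetCard.1 (mem_filter.1 he).1).2]
  have h2 : (#{e ∈ Φ.powersetCard k | HasRelations h ρ e} : ℝ) * (#Φ : ℝ) ^ ρ ≤
      ((2 * h + 1 : ℕ) : ℝ) ^ (k * ρ) * (#Φ : ℝ) ^ k := by
    exact_mod_cast card_hasRelations_mul_le Φ h ρ k
  rw [h1]
  have h3 : (p * #Φ) ^ k ≤ (#Φ : ℝ) ^ ρ * Y ^ g := by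
    calc (p * #Φ) ^ k ≤ (p * #Φ) ^ (ρ * h) := pow_le_pow_right₀ hpN hk.2
      _ = (#Φ : ℝ) ^ ρ * Y ^ ρ := by rw [mul_comm ρ, pow_mul, hY, mul_pow]
      _ ≤ _ := by gcongr; exact hρ.2
  refine le_of_mul_le_mul_right ?_ (pow_pos hN ρ)
  calc _ = (#{e ∈ Φ.powersetCard k | HasRelations h ρ e} : ℝ) * (#Φ : ℝ) ^ ρ * p ^ k := by ring
    _ ≤ ((2 * h + 1 : ℕ) : ℝ) ^ (k * ρ) * (#Φ : ℝ) ^ k * p ^ k := by gcongr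
    _ = ((2 * h + 1 : ℕ) : ℝ) ^ (k * ρ) * (p * #Φ) ^ k := by ring
    _ ≤ ((2 * h + 1 : ℕ) : ℝ) ^ (k * ρ) * ((#Φ : ℝ) ^ ρ * Y ^ g) := by gcongr
    _ = _ := by ring

lemma sum_pow_card_disjointEdges_le {Φ : Finset ℝ} {h k Q : ℕ} {p : ℝ} (hp : 0 ≤ p)
    (hQ : ∀ n, #{T ∈ Φ.powersetCard h | ∑ x ∈ T, x = n} ≤ Q) :
    ∑ e ∈ disjointEdges Φ h k, p ^ #e ≤ (#Φ : ℝ) ^ h * (Q : ℝ) ^ k * p ^ (h * (k + 1)) := by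
  classical
  rw [sum_congr rfl fun e he => by rw [(mem_disjointEdges_props he).2], sum_const, nsmul_eq_mul]
  gcongr
  exact_mod_cast (card_image_le.trans (card_filter_le _ _)).trans
    (card_equal_sum_tuples_le Φ h k Q hQ)

/-- The exponent count for the expected number of `k + 1` disjoint `h`-sets of equal sum, where `q`
bounds the number of `h`-sets of given sum and `Z` is the saving in `q`. -/
lemma weight_le {h k : ℕ} {N D p Y Z q : ℝ} (hN : 0 < N) (hD : 0 ≤ D) (hp : 0 ≤ p) (hq : 0 ≤ q)
    (hqN : q * N ≤ D * N ^ h * Z) (hpN : (p * N) ^ h = N * Y)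
    (hYZ : N * Y ^ (k + 1) * Z ^ k ≤ 1) : N ^ h * q ^ k * p ^ (h * (k + 1)) ≤ D ^ k := by
  have h0 : 0 ≤ N * Y := by rw [← hpN]; positivity
  refine le_of_mul_le_mul_right (a := N ^ k * N ^ (h * k)) ?_ (by positivity)
  calc _ = (q * N) ^ k * ((p * N) ^ h) ^ (k + 1) := by
        rw [mul_pow, ← pow_mul, mul_pow p N]; ring
    _ ≤ (D * N ^ h * Z) ^ k * (N * Y) ^ (k + 1) := by
        rw [hpN]; gcongr
    _ = D ^ k * (N ^ k * N ^ (h * k)) * (N * Y ^ (k + 1) * Z ^ k) := by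
        rw [mul_pow, mul_pow, mul_pow N Y, ← pow_mul]; ring
    _ ≤ D ^ k * (N ^ k * N ^ (h * k)) * 1 := by gcongr
    _ = _ := by ring

lemma card_sym_filter_le_of_card_le_one {h g : ℕ} (hg : 1 ≤ g) {B : Finset ℝ} (hB : #B ≤ 1)
    (n : ℝ) : #((B.sym h).filter fun s : Sym ℝ h => (s : Multiset ℝ).sum = n) ≤ g := by
  refine (card_filter_le _ _).trans (le_trans ?_ hg)
  rw [card_le_one] at hB ⊢
  intro s hs s' hs'
  rw [mem_sym_iff] at hs hs'
  apply Sym.coe_injective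
  rcases B.eq_empty_or_nonempty with rfl | ⟨b, hb⟩
  · have e1 : (s : Multiset ℝ) = 0 := Multiset.eq_zero_of_forall_notMem
      fun a ha => notMem_empty a (hs a ha)
    have e2 : (s' : Multiset ℝ) = 0 := Multiset.eq_zero_of_forall_notMem
      fun a ha => notMem_empty a (hs' a ha)
    rw [e1, e2]
  · exact (Multiset.eq_replicate.2 ⟨s.2, fun a ha => hB a (hs a ha) b hb⟩).trans
      (Multiset.eq_replicate.2 ⟨s'.2, fun a ha => hB a (hs' a ha) b hb⟩).symm

lemma one_div_add_one_div_le_one {x : ℝ} (hx : 3 ≤ x) : 1 / x + 1 / (60 * x ^ 3) ≤ 1 := by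
  have h1 : 1 / x ≤ 1 / 3 := by gcongr
  have h2 : 1 / (60 * x ^ 3) ≤ 1 / (60 * 3 ^ 3) := by gcongr
  have h3 : (1 : ℝ) / (60 * 3 ^ 3) ≤ 1 / 3 := by norm_num
  linarith

/-- If the numbers of representations as sums of three elements have a power saving over the
trivial bound, then the random subset of density `|Φ| ^ (1 / h + 1 / (60 h³) - 1)`, with one point
of each edge removed, is a large set with few representations as sums of `h` elements. -/
theorem exists_subset_card_sym_filter_le {h : ℕ} (hh : 3 ≤ h) {D : ℝ} (hD : 1 ≤ D) :
    ∃ C : ℝ, 0 < C ∧ ∀ Φ : Finset ℝ,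
      (∀ n, (tripleRep Φ n : ℝ) ≤ D * (#Φ : ℝ) ^ (83 / 42 : ℝ)) →
      ∃ B ⊆ Φ,
        (∀ n, #((B.sym h).filter fun s : Sym ℝ h => (s : Multiset ℝ).sum = n) ≤ 30 * h) ∧
        C * (#Φ : ℝ) ^ (1 / (h : ℝ) + 1 / (60 * (h : ℝ) ^ 3)) ≤ #B := by
  set δ : ℝ := 1 / (60 * (h : ℝ) ^ 3) with hδ
  set β : ℝ := 1 / (h : ℝ) + δ with hβ
  have hh3 : (3 : ℝ) ≤ h := by exact_mod_cast hh
  have hh0 : (0 : ℝ) < h := by linarith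
  have hδ0 : 0 < δ := by positivity
  have hβ0 : 0 < β := by positivity
  have hβh : β * h = 1 + h * δ := by rw [hβ]; field_simp
  have hβ1 : β ≤ 1 := one_div_add_one_div_le_one hh3
  have hδg : h * δ * (30 * h : ℕ) = 1 / (2 * h) := by
    rw [hδ]; push_cast; field_simp; norm_num
  obtain ⟨C₁, hC₁⟩ : ∃ C₁ : ℝ, C₁ = ∑ ρ ∈ Icc 1 (30 * h), ∑ k ∈ Icc 1 (ρ * h),
    ((2 * h + 1 : ℕ) : ℝ) ^ (k * ρ) := ⟨_, rfl⟩
  have hC₁0 : 0 ≤ C₁ := by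
    rw [hC₁]
    exact sum_nonneg fun ρ _ => sum_nonneg fun k _ => pow_nonneg (Nat.cast_nonneg _) _
  obtain ⟨C₂, hC₂⟩ : ∃ C₂ : ℝ, C₂ = C₁ + D ^ (27 * h) := ⟨_, rfl⟩
  have hC₂1 : 1 ≤ C₂ := by
    have := one_le_pow₀ (n := 27 * h) hD
    linarith
  have hC₂' : 1 ≤ (2 * C₂) ^ (2 * h) := one_le_pow₀ (by linarith)
  refine ⟨1 / 2 / (2 * C₂) ^ (2 * h), by positivity, fun Φ hΦ => ?_⟩
  have hC2 : 1 / 2 / (2 * C₂) ^ (2 * h) ≤ 1 / 2 := div_le_self (by norm_num) hC₂'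
  rcases Φ.eq_empty_or_nonempty with rfl | hne
  · refine ⟨∅, Subset.refl _, card_sym_filter_le_of_card_le_one (by omega) (by simp), ?_⟩
    rw [card_empty, Nat.cast_zero, Real.zero_rpow hβ0.ne', mul_zero]
  set N : ℝ := (#Φ : ℝ) with hN
  have hN1 : 1 ≤ N := by rw [hN]; exact_mod_cast hne.card_pos
  have hN0 : 0 < N := by linarith
  rcases lt_or_ge (N ^ (1 / (2 * h) : ℝ)) (2 * C₂) with hsmall | hlarge
  · obtain ⟨b, hb⟩ := hne
    refine ⟨{b}, singleton_subset_iff.2 hb,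
      card_sym_filter_le_of_card_le_one (by omega) (by simp), ?_⟩
    have h1 : N ^ β ≤ (2 * C₂) ^ (2 * h) := by
      calc N ^ β ≤ N ^ (1 : ℝ) := Real.rpow_le_rpow_of_exponent_le hN1 hβ1
        _ = (N ^ (1 / (2 * h) : ℝ)) ^ (2 * h) := by
            rw [← Real.rpow_natCast, ← Real.rpow_mul hN0.le]; congr 1; push_cast; field_simp
        _ ≤ _ := by gcongr
    calc 1 / 2 / (2 * C₂) ^ (2 * h) * N ^ β ≤ 1 / 2 / (2 * C₂) ^ (2 * h) * (2 * C₂) ^ (2 * h) := by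
          gcongr
      _ = 1 / 2 := by field_simp
      _ ≤ _ := by rw [card_singleton]; norm_num
  · set p : ℝ := N ^ (β - 1) with hp
    have hp0 : 0 ≤ p := by positivity
    have hp1 : p ≤ 1 := Real.rpow_le_one_of_one_le_of_nonpos hN1 (by linarith)
    have hpN : p * N = N ^ β := by
      rw [hp, ← Real.rpow_add_one hN0.ne']; congr 1; ring
    have hpN1 : 1 ≤ p * N := by rw [hpN]; exact Real.one_le_rpow hN1 hβ0.le
    set Y : ℝ := N ^ (h * δ) with hY
    have hY1 : 1 ≤ Y := Real.one_le_rpow hN1 (by positivity)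
    have hpNh : (p * N) ^ h = N * Y := by
      rw [hpN, ← Real.rpow_natCast, ← Real.rpow_mul hN0.le, hβh, Real.rpow_add hN0, Real.rpow_one]
    have hYg : Y ^ (30 * h) = N ^ (1 / (2 * h) : ℝ) := by
      rw [hY, ← Real.rpow_natCast, ← Real.rpow_mul hN0.le, hδg]
    have hrel := sum_pow_card_relationEdges_le (g := 30 * h) hne hp0 hpN1 hY1 hpNh
    rw [hYg, ← hC₁] at hrel
    -- the exponent `1 / 42` saved by each of the `27 h` further sets outweighs the factor `|Φ|`
    -- coming from the first one, because `27 * 3 / 42 > 1`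
    set Q₀ : ℕ := ⌊D * N ^ (83 / 42 : ℝ)⌋₊ with hQ₀
    have hQ₀' : (Q₀ : ℝ) ≤ D * N ^ (83 / 42 : ℝ) := Nat.floor_le (by positivity)
    have hQ := card_powersetCard_add_three_le Φ Q₀ (fun n => Nat.le_floor (hΦ n)) (h - 3)
    rw [show 3 + (h - 3) = h by omega] at hQ
    have hdis := sum_pow_card_disjointEdges_le (k := 27 * h) hp0 hQ
    have hdis' : N ^ h * ((#Φ ^ (h - 3) * Q₀ : ℕ) : ℝ) ^ (27 * h) * p ^ (h * (27 * h + 1)) ≤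
        D ^ (27 * h) := by
      have e1 : ((#Φ ^ (h - 3) * Q₀ : ℕ) : ℝ) * N ≤ D * N ^ (h : ℝ) * N ^ (-1 / 42 : ℝ) := by
        push_cast
        calc N ^ (h - 3) * (Q₀ : ℝ) * N ≤ N ^ (h - 3) * (D * N ^ (83 / 42 : ℝ)) * N := by gcongr
          _ = D * (N ^ ((h - 3 : ℕ) : ℝ) * N ^ (83 / 42 : ℝ) * N ^ (1 : ℝ)) := by
              rw [Real.rpow_natCast, Real.rpow_one]; ring
          _ = D * (N ^ (h : ℝ) * N ^ (-1 / 42 : ℝ)) := by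
              rw [← Real.rpow_add hN0, ← Real.rpow_add hN0, ← Real.rpow_add hN0]
              congr 2
              rw [Nat.cast_sub hh]; push_cast; ring
          _ = _ := by ring
      rw [Real.rpow_natCast] at e1
      have e2 : N * Y ^ (27 * h + 1) * (N ^ (-1 / 42 : ℝ)) ^ (27 * h) ≤ 1 := by
        rw [hY, ← Real.rpow_natCast, ← Real.rpow_natCast, ← Real.rpow_mul hN0.le,
          ← Real.rpow_mul hN0.le, mul_assoc, ← Real.rpow_add hN0]
        nth_rewrite 1 [← Real.rpow_one N]
        rw [← Real.rpow_add hN0]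
        refine Real.rpow_le_one_of_one_le_of_nonpos hN1 ?_
        have e3 : h * δ * ((27 * h + 1 : ℕ) : ℝ) ≤ 1 / 6 := by
          calc h * δ * ((27 * h + 1 : ℕ) : ℝ) ≤ h * δ * (30 * h : ℕ) := by
                gcongr; omega
            _ = 1 / (2 * h) := hδg
            _ ≤ 1 / (2 * 3) := by gcongr
            _ = _ := by norm_num
        push_cast at e3 ⊢
        linarith
      exact weight_le hN0 (by positivity) hp0 (by positivity) e1 hpNh e2
    classical
    obtain ⟨B, hBΦ, hB, hBc⟩ := exists_subset_no_edge Φ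
      (relationEdges Φ h (30 * h) ∪ disjointEdges Φ h (27 * h)) (by
        intro e he
        rcases mem_union.1 he with he | he
        · exact mem_relationEdges_props he
        · have h1 := mem_disjointEdges_props he
          exact ⟨h1.1, card_pos.1 (by rw [h1.2]; exact Nat.mul_pos (by omega) (by omega))⟩)
      p hp0 hp1
    refine ⟨B, hBΦ, card_sym_filter_le_of_no_edge (by omega) (by omega) hBΦ hB, ?_⟩
    have hunion : ∑ e ∈ relationEdges Φ h (30 * h) ∪ disjointEdges Φ h (27 * h), p ^ #e ≤
        C₂ * N ^ (1 / (2 * h) : ℝ) := by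
      have h1 : ∑ e ∈ relationEdges Φ h (30 * h) ∪ disjointEdges Φ h (27 * h), p ^ #e ≤
          ∑ e ∈ relationEdges Φ h (30 * h), p ^ #e + ∑ e ∈ disjointEdges Φ h (27 * h), p ^ #e := by
        rw [← sum_union_inter]
        have : 0 ≤ ∑ e ∈ relationEdges Φ h (30 * h) ∩ disjointEdges Φ h (27 * h), p ^ #e :=
          sum_nonneg fun _ _ => by positivity
        linarith
      have h2 : 1 ≤ N ^ (1 / (2 * h) : ℝ) := Real.one_le_rpow hN1 (by positivity)
      have h3 : D ^ (27 * h) ≤ D ^ (27 * h) * N ^ (1 / (2 * h) : ℝ) :=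
        le_mul_of_one_le_right (by positivity) h2
      rw [hC₂, add_mul]
      linarith
    have hsq : N ^ (1 / (2 * h) : ℝ) * N ^ (1 / (2 * h) : ℝ) ≤ N ^ β := by
      rw [← Real.rpow_add hN0]
      refine Real.rpow_le_rpow_of_exponent_le hN1 ?_
      have : 1 / (2 * h : ℝ) + 1 / (2 * h) = 1 / h := by field_simp; norm_num
      rw [this, hβ]; linarith
    have hhalf : C₂ * N ^ (1 / (2 * h) : ℝ) ≤ 1 / 2 * N ^ β := by
      have h0 : 0 ≤ N ^ (1 / (2 * h) : ℝ) := by positivity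
      nlinarith
    rw [hpN] at hBc
    have h4 : 0 ≤ N ^ β := by positivity
    have h5 := mul_le_mul_of_nonneg_right hC2 h4
    linarith

/-! ### From real numbers to integers -/

/-- Representations over a set of integers are no more numerous than the corresponding
representations over its image under an injection into the reals. -/
lemma card_sym_filter_le_of_image {h g : ℕ} {B : Finset ℤ} {φ : ℤ → ℝ} (hφ : Set.InjOn φ B)
    (hB : ∀ x : ℝ,
      #((B.image φ).sym h |>.filter fun s : Sym ℝ h => (s : Multiset ℝ).sum = x) ≤ g)
    {p : Sym ℤ h → Prop} [DecidablePred p] {x : ℝ}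
    (hp : ∀ s ∈ B.sym h, p s → ((s : Multiset ℤ).map φ).sum = x) :
    #((B.sym h).filter p) ≤ g := by
  refine le_trans (card_le_card_of_injOn (fun s => Sym.map φ s) ?_ ?_) (hB x)
  · intro s hs
    rw [mem_coe, mem_filter] at hs
    rw [mem_coe, mem_filter, mem_sym_iff]
    refine ⟨fun a ha => ?_, ?_⟩
    · obtain ⟨b, hb, rfl⟩ := Sym.mem_map.1 ha
      exact mem_image_of_mem φ (mem_sym_iff.1 hs.1 b hb)
    · rw [Sym.coe_map]
      exact hp s hs.1 hs.2
  · intro s hs s' hs' e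
    rw [mem_coe, mem_filter, mem_sym_iff] at hs hs'
    have e' : (s : Multiset ℤ).map φ = (s' : Multiset ℤ).map φ := by
      rw [← Sym.coe_map, ← Sym.coe_map]; exact congrArg _ e
    -- a left inverse of `φ` on `B` recovers the multisets
    have hinv : ∀ s : Sym ℤ h, (∀ a ∈ s, a ∈ B) →
        ((s : Multiset ℤ).map φ).map (Function.invFunOn φ B) = s := by
      intro s hs
      rw [Multiset.map_map]
      conv_rhs => rw [← Multiset.map_id (s : Multiset ℤ)]
      exact Multiset.map_congr rfl fun a ha =>
        hφ.leftInvOn_invFunOn (hs a ha)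
    apply Sym.coe_injective
    have h1 := hinv s hs.1
    rw [e', hinv s' hs'.1] at h1
    exact h1.symm

lemma exists_subset_same_sign (A : Finset ℤ) :
    ∃ ε : ℤ, (ε = 1 ∨ ε = -1) ∧ ∃ A' ⊆ A, (∀ a ∈ A', 0 < ε * a) ∧ #A ≤ 2 * #A' + 1 := by
  have h1 : #A ≤ #{a ∈ A | 0 < a} + #{a ∈ A | a < 0} + 1 := by
    have hsub : A ⊆ ({a ∈ A | 0 < a} ∪ {a ∈ A | a < 0}) ∪ {0} := by
      intro a ha
      simp only [mem_union, mem_filter, mem_singleton, ha, true_and]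
      omega
    have h2 := (card_le_card hsub).trans (card_union_le _ _)
    have h3 := card_union_le {a ∈ A | 0 < a} {a ∈ A | a < 0}
    rw [card_singleton] at h2
    omega
  rcases le_total #{a ∈ A | a < 0} #{a ∈ A | 0 < a} with h | h
  · refine ⟨1, Or.inl rfl, {a ∈ A | 0 < a}, filter_subset _ _, fun a ha => ?_, by omega⟩
    have := (mem_filter.1 ha).2; omega
  · refine ⟨-1, Or.inr rfl, {a ∈ A | a < 0}, filter_subset _ _, fun a ha => ?_, by omega⟩
    have := (mem_filter.1 ha).2; omega

lemma isAddBhg_of_image {h g : ℕ} {B : Finset ℤ} {ε : ℤ} (hε : ε = 1 ∨ ε = -1)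
    (hB : ∀ x : ℝ, #((B.image fun a : ℤ => (ε : ℝ) * a).sym h |>.filter
      fun s : Sym ℝ h => (s : Multiset ℝ).sum = x) ≤ g) : IsAddBhg h g B := by
  intro n
  refine card_sym_filter_le_of_image (φ := fun a : ℤ => (ε : ℝ) * a) ?_ hB
    (x := (ε : ℝ) * n) ?_
  · intro a _ b _ hab
    have : ε * a = ε * b := by
      have hab' : (ε : ℝ) * a = ε * b := hab
      exact_mod_cast hab'
    rcases hε with rfl | rfl <;> omega
  · intro s _ hs
    rw [← hs, Multiset.sum_map_mul_left]
    congr 1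
    exact (map_multiset_sum (Int.castRingHom ℝ) (s : Multiset ℤ)).symm

lemma sum_map_log (s : Multiset ℤ) (hs : ∀ a ∈ s, a ≠ 0) :
    (s.map fun a : ℤ => Real.log a).sum = Real.log (s.prod : ℤ) := by
  induction s using Multiset.induction_on with
  | empty => simp
  | cons a s ih =>
    have ha : (a : ℝ) ≠ 0 := by exact_mod_cast hs a (Multiset.mem_cons_self _ _)
    have hs' : ∀ b ∈ s, b ≠ 0 := fun b hb => hs b (Multiset.mem_cons_of_mem hb)
    have hp : ((s.prod : ℤ) : ℝ) ≠ 0 := by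
      exact_mod_cast Multiset.prod_ne_zero fun h0 => hs' 0 h0 rfl
    rw [Multiset.map_cons, Multiset.sum_cons, Multiset.prod_cons, ih hs', Int.cast_mul,
      Real.log_mul ha hp]

lemma exp_log_eq {ε a : ℤ} (hε : ε = 1 ∨ ε = -1) (ha : 0 < ε * a) :
    Real.exp (Real.log a) = ε * a := by
  have ha' : (0 : ℝ) < ε * a := by exact_mod_cast ha
  rcases hε with rfl | rfl
  · push_cast at ha' ⊢
    rw [one_mul] at ha' ⊢
    exact Real.exp_log ha'
  · push_cast at ha' ⊢
    rw [← Real.log_neg_eq_log, Real.exp_log (by linarith)]; ring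

lemma injOn_log {ε : ℤ} (hε : ε = 1 ∨ ε = -1) {A : Finset ℤ} (hA : ∀ a ∈ A, 0 < ε * a) :
    Set.InjOn (fun a : ℤ => Real.log a) A := by
  intro a ha b hb hab
  have h1 : (ε : ℝ) * a = ε * b := by
    rw [← exp_log_eq hε (hA a ha), ← exp_log_eq hε (hA b hb)]
    exact congrArg Real.exp hab
  have : ε * a = ε * b := by exact_mod_cast h1
  rcases hε with rfl | rfl <;> omega

/-- On nonzero integers of one sign the logarithm of the absolute value (`Real.log` ignores the
sign) is injective and turns products into sums. -/
lemma isMulBhg_of_image_log {h g : ℕ} {B : Finset ℤ} {ε : ℤ} (hε : ε = 1 ∨ ε = -1)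
    (hBε : ∀ a ∈ B, 0 < ε * a)
    (hB : ∀ x : ℝ, #((B.image fun a : ℤ => Real.log a).sym h |>.filter
      fun s : Sym ℝ h => (s : Multiset ℝ).sum = x) ≤ g) : IsMulBhg h g B := by
  intro n
  refine card_sym_filter_le_of_image (φ := fun a : ℤ => Real.log a) (injOn_log hε hBε) hB
    (x := Real.log n) ?_
  intro s hs hn
  rw [← hn]
  refine sum_map_log _ fun a ha h0 => ?_
  have := hBε a (mem_sym_iff.1 hs a ha)
  rw [h0, mul_zero] at this
  exact lt_irrefl _ this

lemma isAddBhg_of_card_le_one {h g : ℕ} (hg : 1 ≤ g) {B : Finset ℤ} (hB : #B ≤ 1) :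
    IsAddBhg h g B := by
  refine isAddBhg_of_image (ε := 1) (Or.inl rfl) fun x => ?_
  exact card_sym_filter_le_of_card_le_one hg (card_image_le.trans hB) x

theorem theorem1p2 :
    ∃ c : ℝ, 0 < c ∧
      ∀ h : ℕ, 3 ≤ h →
        ∃ (g : ℕ) (δ C : ℝ), 1 ≤ g ∧ g ≤ 30 * h ∧ c / (h : ℝ) ^ 3 ≤ δ ∧ 0 < C ∧
          ∀ A : Finset ℤ,
            ∃ B : Finset ℤ, B ⊆ A ∧ (IsAddBhg h g B ∨ IsMulBhg h g B) ∧
              C * (A.card : ℝ) ^ (1 / (h : ℝ) + δ) ≤ (B.card : ℝ) := by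
  refine ⟨1 / 60, by norm_num, fun h hh => ?_⟩
  obtain ⟨C, hC, hmain⟩ := exists_subset_card_sym_filter_le hh (D := 2 ^ 20) (by norm_num)
  have hh3 : (3 : ℝ) ≤ h := by exact_mod_cast hh
  have hh0 : (0 : ℝ) < h := by linarith
  refine ⟨30 * h, 1 / (60 * (h : ℝ) ^ 3), min (C / 5) 1, by omega, le_rfl, ?_, by positivity, ?_⟩
  · rw [div_div]
  set β : ℝ := 1 / (h : ℝ) + 1 / (60 * (h : ℝ) ^ 3) with hβ
  have hβ0 : 0 < β := by positivity
  have hβ1 : β ≤ 1 := one_div_add_one_div_le_one hh3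
  intro A
  rcases le_or_gt #A 1 with hA1 | hA1
  · refine ⟨A, Subset.refl _, Or.inl (isAddBhg_of_card_le_one (by omega) hA1), ?_⟩
    have h1 : (#A : ℝ) ^ β = #A := by
      rcases (by omega : #A = 0 ∨ #A = 1) with h0 | h0 <;> rw [h0] <;> simp [hβ0.ne']
    rw [h1]
    exact mul_le_of_le_one_left (Nat.cast_nonneg _) (min_le_right _ _)
  obtain ⟨ε, hε, A', hA'A, hA'ε, hA'c⟩ := exists_subset_same_sign A
  have hlogc : #(A'.image fun a : ℤ => Real.log a) = #A' :=
    card_image_of_injOn (injOn_log hε hA'ε)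
  have hexp : ∀ A'' ⊆ A', (A''.image fun a : ℤ => Real.log a).image Real.exp =
      A''.image fun a : ℤ => (ε : ℝ) * a := by
    intro A'' hA''
    rw [image_image]
    exact image_congr fun a ha => exp_log_eq hε (hA'ε a (hA'' ha))
  obtain ⟨L, hL, hLc, hrep⟩ := exists_subset_tripleRep_le (A'.image fun a : ℤ => Real.log a)
  obtain ⟨A'', hA'', rfl⟩ := subset_image_iff.1 hL
  have hA''A' : A'' ⊆ A' := by exact_mod_cast hA''
  have hcard'' : #(A''.image fun a : ℤ => Real.log a) = #A'' :=
    card_image_of_injOn (injOn_log hε fun a ha => hA'ε a (hA''A' ha))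
  rw [hlogc, hcard''] at hLc
  rw [hcard''] at hrep
  have hsize : (#A : ℝ) ≤ 5 * #A'' := by exact_mod_cast (by omega : #A ≤ 5 * #A'')
  have hfin : ∀ B : Finset ℤ, C * (#A'' : ℝ) ^ β ≤ #B → min (C / 5) 1 * (#A : ℝ) ^ β ≤ #B := by
    intro B hB
    have h5 : (5 : ℝ) ^ β ≤ 5 := by
      calc (5 : ℝ) ^ β ≤ 5 ^ (1 : ℝ) := Real.rpow_le_rpow_of_exponent_le (by norm_num) hβ1
        _ = 5 := Real.rpow_one 5
    calc min (C / 5) 1 * (#A : ℝ) ^ β ≤ C / 5 * (5 * #A'') ^ β := by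
          gcongr
          exact min_le_left _ _
      _ = C / 5 * (5 ^ β * (#A'' : ℝ) ^ β) := by
          rw [Real.mul_rpow (by norm_num) (Nat.cast_nonneg _)]
      _ ≤ C / 5 * (5 * (#A'' : ℝ) ^ β) := by gcongr
      _ = C * (#A'' : ℝ) ^ β := by ring
      _ ≤ _ := hB
  rcases hrep with hrep | hrep
  · have hc : #((A''.image fun a : ℤ => Real.log a).image Real.exp) = #A'' := by
      rw [card_image_of_injective _ Real.exp_injective, hcard'']
    obtain ⟨B₀, hB₀, hB₀g, hB₀c⟩ := hmain _ (by rw [hc]; exact hrep)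
    rw [hc] at hB₀c
    rw [hexp _ hA''A'] at hB₀
    obtain ⟨B, hB, rfl⟩ := subset_image_iff.1 hB₀
    have hBA'' : B ⊆ A'' := by exact_mod_cast hB
    refine ⟨B, (hBA''.trans hA''A').trans hA'A, Or.inl (isAddBhg_of_image hε hB₀g),
      hfin B (hB₀c.trans ?_)⟩
    exact_mod_cast card_image_le
  · obtain ⟨B₀, hB₀, hB₀g, hB₀c⟩ := hmain _ (by rw [hcard'']; exact hrep)
    rw [hcard''] at hB₀c
    obtain ⟨B, hB, rfl⟩ := subset_image_iff.1 hB₀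
    have hBA'' : B ⊆ A'' := by exact_mod_cast hB
    refine ⟨B, (hBA''.trans hA''A').trans hA'A,
      Or.inr (isMulBhg_of_image_log hε (fun a ha => hA'ε a (hA''A' (hBA'' ha))) hB₀g),
      hfin B (hB₀c.trans ?_)⟩
    exact_mod_cast card_image_le
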